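/- Let $\mathbb{K}$ be an algebraically closed field and let $\mathcal{Q}=(Q,I)$ be a finite connected gentle quiver: $Q$ is a finite connected quiver with at most two incoming and at most two outgoing arrows at each vertex, and $I$ is an admissible ideal of the path algebra $\mathbb{K}Q$ (that is, $\mathbb{K}Q_{\geqslant N}\subseteq I\subseteq \mathbb{K}Q_{\geqslant 2}$ for some $N>0$, where $\mathbb{K}Q_{\geqslant l}$ is the ideal generated by the paths of length at least $l$), generated by some paths of length $2$, such that for every arrow $\alpha$ there is at most one arrow $\beta$ with $t(\beta)=s(\alpha)$ and $\alpha\beta\in I$, at most one arrow $\gamma$ with $s(\gamma)=t(\alpha)$ and $\gamma\alpha\in I$, at most one arrow $\beta'$ with $t(\beta')=s(\alpha)$ and $\alpha\beta'\notin I$, and at most one arrow $\gamma'$ with $s(\gamma')=t(\alpha)$ and $\gamma'\alpha\notin I$ (here $\alpha\beta$ denotes the path $\beta$ followed by $\alpha$). A representation $X$ of $\mathcal{Q}$ consists of finite-dimensional $\mathbb{K}$-vector spaces $X_q$ for the vertices $q$ and linear maps $X_\alpha\colon X_{s(\alpha)}\to X_{t(\alpha)}$ for the arrows $\alpha$, with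 $X_\alpha X_\beta=0$ whenever $\alpha\beta\in I$. A nilpotent endomorphism $N$ of $X$ has Jordan form data $\mathsf{JF}(N)=(\lambda^q)_{q}$, where $\lambda^q\vdash\dim X_q$ lists the sizes of the Jordan blocks of $N_q$. The generic Jordan form data $\mathsf{GenJF}(X)$ is the maximum of $\mathsf{JF}(N)$ over all nilpotent endomorphisms $N$ of $X$, for the vertexwise dominance order. A full subcategory $\mathscr{C}$ of the category of representations of $\mathcal{Q}$, closed under direct sums and direct summands, is Jordan recoverable if for every tuple of partitions $\underline{\lambda}$ there is, up to isomorphism, at most one $X\in\mathscr{C}$ with $\mathsf{GenJF}(X)=\underline{\lambda}$. For a vertex $m$, let $\mathscr{C}_{\mathcal{Q},m}$ be the subcategory generated, under direct sums and direct summands, by the indecomposable representations $X$ with $\dim X_m\geqslant 1$. The vertex $m$ is minuscule if $\dim X_m\leqslant 1$ for every indecomposable representation $X$ of $\mathcal{Q}$. Proposition. If a vertex $m$ of $\mathcal{Q}$ is not minuscule, then $\mathscr{C}_{\mathcal{Q},m}$ is not Jordan recoverable. -/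

import Mathlib

universe u v w

namespace GentleQuiver

noncomputable section

/-! ### The path algebra, admissible ideals and gentle quivers -/

/-- The path algebra `KQ`: the `K`-vector space with basis all paths of the quiver (including the
lazy ones), with the concatenation product defined below. -/
def PathAlgebra (K : Type u) [Field K] (V : Type v) [Quiver.{w} V] : Type (max u v w) :=
  (Σ a b : V, Quiver.Path a b) →₀ K

namespace PathAlgebra

variable {K : Type u} [Field K] {V : Type v} [Quiver.{w} V]

instance : AddCommGroup (PathAlgebra K V) :=
  inferInstanceAs (AddCommGroup ((Σ a b : V, Quiver.Path a b) →₀ K))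

instance : Module K (PathAlgebra K V) :=
  inferInstanceAs (Module K ((Σ a b : V, Quiver.Path a b) →₀ K))

/-- The basis element of `KQ` given by a path. -/
def ofPath {a b : V} (p : Quiver.Path a b) : PathAlgebra K V :=
  Finsupp.single (⟨a, b, p⟩ : Σ a b : V, Quiver.Path a b) (1 : K)

open Classical in
/-- The product of two basis paths, written from right to left (as composition of maps is):
`p q` is "`q` and then `p`" if `q` ends where `p` starts, and `0` otherwise. -/
def basisMul (p q : Σ a b : V, Quiver.Path a b) : PathAlgebra K V :=
  if h : q.2.1 = p.1 then ofPath ((q.2.2.cast rfl h).comp p.2.2) else 0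

/-- The product of the path algebra, as the bilinear extension of `basisMul`. -/
def mulBilin : PathAlgebra K V →ₗ[K] PathAlgebra K V →ₗ[K] PathAlgebra K V :=
  Finsupp.linearCombination K (fun p : Σ a b : V, Quiver.Path a b =>
    (Finsupp.linearCombination K (fun q : Σ a b : V, Quiver.Path a b => basisMul p q) :
      ((Σ a b : V, Quiver.Path a b) →₀ K) →ₗ[K] PathAlgebra K V))

instance : Mul (PathAlgebra K V) := ⟨fun x y => mulBilin x y⟩

theorem mul_def (x y : PathAlgebra K V) : x * y = mulBilin x y := rfl

theorem basis_mul {a b c d : V} (q : Quiver.Path a b) (p : Quiver.Path c d) :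
    (ofPath p * ofPath q : PathAlgebra K V) = basisMul ⟨c, d, p⟩ ⟨a, b, q⟩ := by
  rw [mul_def, mulBilin, ofPath, ofPath]
  erw [Finsupp.linearCombination_single, one_smul, Finsupp.linearCombination_single, one_smul]

theorem ofPath_mul_ofPath {a b c : V} (q : Quiver.Path a b) (p : Quiver.Path b c) :
    (ofPath p * ofPath q : PathAlgebra K V) = ofPath (q.comp p) := by
  rw [basis_mul]
  simp [basisMul]

theorem ofPath_mul_ofPath_of_ne {a b c d : V} (q : Quiver.Path a b) (p : Quiver.Path c d)
    (h : b ≠ c) :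
    (ofPath p * ofPath q : PathAlgebra K V) = 0 := by
  rw [basis_mul]
  simp [basisMul, h]

theorem ofPath_induction {P : PathAlgebra K V → Prop} (x : PathAlgebra K V) (h0 : P 0)
    (hadd : ∀ x y, P x → P y → P (x + y))
    (hs : ∀ (c : K) (a b : V) (p : Quiver.Path a b), P (c • ofPath p)) : P x := by
  refine Finsupp.induction_linear x h0 hadd ?_
  rintro ⟨a, b, p⟩ c
  have h : (Finsupp.single (⟨a, b, p⟩ : Σ a b : V, Quiver.Path a b) c) =
      c • Finsupp.single (⟨a, b, p⟩ : Σ a b : V, Quiver.Path a b) (1 : K) := by simp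
  rw [h]
  exact hs c a b p

theorem smul_mul' (c : K) (x y : PathAlgebra K V) : (c • x) * y = c • (x * y) := by
  simp [mul_def]

theorem mul_smul' (c : K) (x y : PathAlgebra K V) : x * (c • y) = c • (x * y) := by
  simp [mul_def]

instance : NonUnitalNonAssocRing (PathAlgebra K V) where
  left_distrib x y z := by simp [mul_def]
  right_distrib x y z := by simp [mul_def]
  zero_mul x := by simp [mul_def]
  mul_zero x := by simp [mul_def]

theorem ofPath_assoc {a b c d e f : V} (p : Quiver.Path a b) (q : Quiver.Path c d)
    (r : Quiver.Path e f) :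
    (ofPath p * ofPath q * ofPath r : PathAlgebra K V) = ofPath p * (ofPath q * ofPath r) := by
  by_cases h1 : d = a
  · subst h1
    by_cases h2 : f = c
    · subst h2
      simp [ofPath_mul_ofPath, Quiver.Path.comp_assoc]
    · simp [ofPath_mul_ofPath, ofPath_mul_ofPath_of_ne _ _ h2]
  · by_cases h2 : f = c
    · subst h2
      simp [ofPath_mul_ofPath, ofPath_mul_ofPath_of_ne _ _ h1]
    · simp [ofPath_mul_ofPath_of_ne _ _ h1, ofPath_mul_ofPath_of_ne _ _ h2]

instance : NonUnitalRing (PathAlgebra K V) where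
  mul_assoc x y z := by
    induction x using ofPath_induction with
    | h0 => simp
    | hadd x x' hx hx' => simp [add_mul, hx, hx']
    | hs c a b p =>
      induction y using ofPath_induction with
      | h0 => simp
      | hadd y y' hy hy' => simp [add_mul, mul_add, hy, hy']
      | hs c' a' b' p' =>
        induction z using ofPath_induction with
        | h0 => simp
        | hadd z z' hz hz' => simp [mul_add, hz, hz']
        | hs c'' a'' b'' p'' => simp [smul_mul', mul_smul', ofPath_assoc]

/-- For a quiver with finitely many vertices the path algebra is unital, the unit being the sum of
the lazy paths. In particular its two-sided ideals are subspaces. -/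
theorem exists_unit [Finite V] : ∃ e : PathAlgebra K V, ∀ x, e * x = x ∧ x * e = x := by
  have := Fintype.ofFinite V
  refine ⟨∑ a : V, ofPath (Quiver.Path.nil : Quiver.Path a a), fun x => ?_⟩
  induction x using ofPath_induction with
  | h0 => simp
  | hadd x y hx hy => rw [mul_add, add_mul, hx.1, hx.2, hy.1, hy.2]; exact ⟨rfl, rfl⟩
  | hs c a b p =>
    constructor
    · rw [mul_smul', Finset.sum_mul, Finset.sum_eq_single b, ofPath_mul_ofPath,
        Quiver.Path.comp_nil]
      · intro d _ hd
        exact ofPath_mul_ofPath_of_ne _ _ hd.symm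
      · simp
    · rw [smul_mul', Finset.mul_sum, Finset.sum_eq_single a, ofPath_mul_ofPath,
        Quiver.Path.nil_comp]
      · intro d _ hd
        exact ofPath_mul_ofPath_of_ne _ _ hd
      · simp

end PathAlgebra

open PathAlgebra

section Gentle

variable {K : Type u} [Field K] {V : Type v} [Quiver.{w} V]

variable (K V) in
/-- The ideal `KQ_{≥ l}` of the path algebra generated by the paths of length at least `l`. -/
def pathIdeal (l : ℕ) : TwoSidedIdeal (PathAlgebra K V) :=
  TwoSidedIdeal.span {x | ∃ (a b : V) (p : Quiver.Path a b), l ≤ p.length ∧ x = ofPath p}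

/-- An admissible ideal: `KQ_{≥ N} ⊆ I ⊆ KQ_{≥ 2}` for some `N > 0`. -/
def IsAdmissible (I : TwoSidedIdeal (PathAlgebra K V)) : Prop :=
  (∃ N : ℕ, 0 < N ∧ pathIdeal K V N ≤ I) ∧ I ≤ pathIdeal K V 2

/-- For consecutive arrows `β : a ⟶ b` and `α : b ⟶ c`, the assertion `αβ ∈ I`. -/
def InRel (I : TwoSidedIdeal (PathAlgebra K V)) {a b c : V} (α : b ⟶ c) (β : a ⟶ b) : Prop :=
  (ofPath α.toPath * ofPath β.toPath : PathAlgebra K V) ∈ I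

/-- `(Q, I)` is a gentle quiver. -/
structure IsGentle (I : TwoSidedIdeal (PathAlgebra K V)) : Prop where
  /-- there are at most two incoming arrows at each vertex -/
  incoming_le_two : ∀ b : V, ENat.card (Σ a : V, (a ⟶ b)) ≤ 2
  /-- there are at most two outgoing arrows at each vertex -/
  outgoing_le_two : ∀ a : V, ENat.card (Σ b : V, (a ⟶ b)) ≤ 2
  /-- the ideal is admissible -/
  admissible : IsAdmissible I
  /-- the ideal is generated by some paths of length two -/
  generated : ∃ R : Set (PathAlgebra K V),
    (∀ x ∈ R, ∃ (a b : V) (p : Quiver.Path a b), p.length = 2 ∧ x = ofPath p) ∧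
      I = TwoSidedIdeal.span R
  /-- for every arrow `α`, at most one arrow `β` with `s(α) = t(β)` and `αβ ∈ I` -/
  before_mem : ∀ {b c : V} (α : b ⟶ c), {β : Σ a : V, (a ⟶ b) | InRel I α β.2}.Subsingleton
  /-- for every arrow `α`, at most one arrow `γ` with `s(γ) = t(α)` and `γα ∈ I` -/
  after_mem : ∀ {a b : V} (α : a ⟶ b), {γ : Σ c : V, (b ⟶ c) | InRel I γ.2 α}.Subsingleton
  /-- for every arrow `α`, at most one arrow `β` with `s(α) = t(β)` and `αβ ∉ I` -/
  before_notMem : ∀ {b c : V} (α : b ⟶ c), {β : Σ a : V, (a ⟶ b) | ¬ InRel I α β.2}.Subsingleton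
  /-- for every arrow `α`, at most one arrow `γ` with `s(γ) = t(α)` and `γα ∉ I` -/
  after_notMem : ∀ {a b : V} (α : a ⟶ b), {γ : Σ c : V, (b ⟶ c) | ¬ InRel I γ.2 α}.Subsingleton

variable (V) in
/-- The quiver is connected, i.e. nonempty and any two vertices are joined by a walk along
arrows and inverses of arrows. -/
def IsConnectedQuiver : Prop :=
  Nonempty V ∧ Subsingleton (Quiver.WeaklyConnectedComponent V)

end Gentle

/-! ### Representations -/

/-- A (finite-dimensional) representation of `(Q, I)` over `K`. -/
structure QuiverRep {K : Type u} [Field K] {V : Type v} [Quiver.{w} V]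
    (I : TwoSidedIdeal (PathAlgebra K V)) where
  /-- the vector space at each vertex -/
  obj : V → Type u
  [addCommGroup : ∀ q, AddCommGroup (obj q)]
  [module : ∀ q, Module K (obj q)]
  [finiteDimensional : ∀ q, FiniteDimensional K (obj q)]
  /-- the linear map of each arrow -/
  map : ∀ {a b : V}, (a ⟶ b) → (obj a →ₗ[K] obj b)
  map_comp_eq_zero : ∀ {a b c : V} (β : a ⟶ b) (α : b ⟶ c), InRel I α β → map α ∘ₗ map β = 0

namespace QuiverRep

attribute [instance] QuiverRep.addCommGroup QuiverRep.module QuiverRep.finiteDimensional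

variable {K : Type u} [Field K] {V : Type v} [Quiver.{w} V]
  {I : TwoSidedIdeal (PathAlgebra K V)}

/-- Morphisms of representations. -/
structure Hom (X Y : QuiverRep I) where
  /-- the linear map at each vertex -/
  app : ∀ q : V, X.obj q →ₗ[K] Y.obj q
  comm : ∀ {a b : V} (α : a ⟶ b), Y.map α ∘ₗ app a = app b ∘ₗ X.map α

/-- `X ≅ Y`: there is a morphism from `X` to `Y` all of whose components are bijective
(the inverses of the components then form a morphism from `Y` to `X`). -/
def Isomorphic (X Y : QuiverRep I) : Prop :=
  ∃ f : Hom X Y, ∀ q : V, Function.Bijective (f.app q)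

/-- `X ≅ 0`. -/
def IsZero (X : QuiverRep I) : Prop :=
  ∀ q : V, Subsingleton (X.obj q)

/-- The direct sum of two representations. -/
def directSum (X Y : QuiverRep I) : QuiverRep I where
  obj q := X.obj q × Y.obj q
  map α := (X.map α).prodMap (Y.map α)
  map_comp_eq_zero β α h := by
    have h1 := fun x => LinearMap.congr_fun (X.map_comp_eq_zero β α h) x
    have h2 := fun y => LinearMap.congr_fun (Y.map_comp_eq_zero β α h) y
    refine LinearMap.ext fun z => Prod.ext (h1 z.1) (h2 z.2)

/-- Indecomposable representations. -/
def Indecomposable (M : QuiverRep I) : Prop :=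
  ¬ M.IsZero ∧ ∀ X Y : QuiverRep I, M.Isomorphic (X.directSum Y) → X.IsZero ∨ Y.IsZero

/-- Nilpotent endomorphisms: `N ^ k = 0` for some `k > 0`. -/
def Hom.IsNilpotent {X : QuiverRep I} (N : Hom X X) : Prop :=
  ∃ k : ℕ, 0 < k ∧ ∀ q : V, N.app q ^ k = 0

end QuiverRep

/-- The vertex `m` is minuscule. -/
def IsMinuscule {K : Type u} [Field K] {V : Type v} [Quiver.{w} V]
    (I : TwoSidedIdeal (PathAlgebra K V)) (m : V) : Prop :=
  ∀ X : QuiverRep I, X.Indecomposable → Module.finrank K (X.obj m) ≤ 1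

/-! ### Subcategories

Full subcategories are given by their classes of objects. -/

/-- The smallest full subcategory that is closed under finite direct sums and direct summands
(in particular under isomorphism) and contains the objects in `S`. -/
inductive AddClosure {K : Type u} [Field K] {V : Type v} [Quiver.{w} V]
    {I : TwoSidedIdeal (PathAlgebra K V)} (S : QuiverRep I → Prop) : QuiverRep I → Prop
  | of (X : QuiverRep I) : S X → AddClosure S X
  | zero (X : QuiverRep I) : X.IsZero → AddClosure S X
  | directSum (X Y : QuiverRep I) : AddClosure S X → AddClosure S Y → AddClosure S (X.directSum Y)
  | summand (X Y Z : QuiverRep I) : AddClosure S Z → Z.Isomorphic (X.directSum Y) → AddClosure S X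

/-- The subcategory `𝒞_{Q,m}`, generated by the indecomposable representations that are
supported at `m`. -/
def supportedAt {K : Type u} [Field K] {V : Type v} [Quiver.{w} V]
    (I : TwoSidedIdeal (PathAlgebra K V)) (m : V) : QuiverRep I → Prop :=
  AddClosure (fun X : QuiverRep I => X.Indecomposable ∧ 1 ≤ Module.finrank K (X.obj m))

/-! ### Generic Jordan form data and Jordan recoverability

A partition is encoded by its Young diagram: the parts are the row lengths, followed by zeros. -/

/-- The endomorphism `f` is nilpotent with Jordan form of type `μ`, with one Jordan block of size
`μ.rowLen i` for each nonempty row `i` of `μ`: there is a basis indexed by the cells of `μ` on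
which `f` shifts each row by one. -/
def HasJordanType {K : Type u} [Field K] {E : Type u} [AddCommGroup E] [Module K E]
    (f : E →ₗ[K] E) (μ : YoungDiagram) : Prop :=
  ∃ e : Module.Basis {c : ℕ × ℕ // c ∈ μ} K E, ∀ (i j : ℕ) (h : (i, j) ∈ μ),
    f (e ⟨(i, j), h⟩) = if h' : (i, j + 1) ∈ μ then e ⟨(i, j + 1), h'⟩ else 0

/-- The dominance order `μ ⊴ ν` (for partitions of the same integer). -/
def Dominated (μ ν : YoungDiagram) : Prop :=
  ∀ k : ℕ, ∑ i ∈ Finset.range k, μ.rowLen i ≤ ∑ i ∈ Finset.range k, ν.rowLen i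

section GenJF

variable {K : Type u} [Field K] {V : Type v} [Quiver.{w} V]
  {I : TwoSidedIdeal (PathAlgebra K V)}

/-- `JF(N) = lam`, for an endomorphism `N`. -/
def HasJF {X : QuiverRep I} (N : QuiverRep.Hom X X) (lam : V → YoungDiagram) : Prop :=
  ∀ q : V, HasJordanType (N.app q) (lam q)

/-- `GenJF(X) = lam`: the tuple of partitions `lam` is the maximum of `JF` on the nilpotent
endomorphisms of `X`, for the vertexwise dominance order. -/
def HasGenJF (X : QuiverRep I) (lam : V → YoungDiagram) : Prop :=
  (∃ N : QuiverRep.Hom X X, N.IsNilpotent ∧ HasJF N lam) ∧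
    ∀ N : QuiverRep.Hom X X, N.IsNilpotent → ∀ μ : V → YoungDiagram, HasJF N μ →
      ∀ q : V, Dominated (μ q) (lam q)

/-- A subcategory is Jordan recoverable if for any tuple of partitions `lam` it has, up to
isomorphism, at most one object `X` with `GenJF(X) = lam`. -/
def JordanRecoverable (C : QuiverRep I → Prop) : Prop :=
  ∀ lam : V → YoungDiagram, ∀ X Y : QuiverRep I, C X → C Y → HasGenJF X lam → HasGenJF Y lam →
    X.Isomorphic Y

end GenJF

end

end GentleQuiver

/-!
The proof does not use a classification of the indecomposable representations.

The gentle axioms allow one to distribute the ends of the arrows over two sides of each vertex such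
that every side has at most one arriving and one leaving arrow, and two composable arrows form a
relation exactly when they meet on the same side (`Sides`, `IsGentle.exists_sides`). Strings are
then the walks that pass every vertex from one side to the other. The vertex `m` is compared with
the condition `NoReturn` that no walk starting at `m` comes back to `m`.

If `𝒞_{Q,m}` is Jordan recoverable, then no walk returns (`JordanRecoverable.noReturn`). Indeed,
consider a walk from `m` without repeated vertices which an arrow `a` continues to a vertex visited
before, either `m` itself or one that is now passed in the opposite direction. In general, let `b`
be the arrow through which that vertex was left. Exchanging `b` for `a` turns the thin
representation of the walk into another one with the same support; thin representations have no
nonzero nilpotent endomorphisms, so the generic Jordan form data agree. If `a` is a loop with both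
ends on one side, then two copies `T ⊕ T` of the thin representation of the walk and the
indecomposable representation in which `a` links the two copies both have a nilpotent endomorphism
with a single Jordan block of size two at each vertex, which is the largest possible type. If `a`
is a loop at `m` with ends on both sides, it can act as zero or as the identity.

If no walk returns, then `m` is minuscule (`Sides.NoReturn.isMinuscule`). For a representation `X`
the walks on either side of `m` define a chain of subspaces of `X_m`. There are a vector `e` and a
functional `ξ` with `ξ e = 1` which are compatible with both chains (`exists_adapted`), and these
can be transported along a walk on each side, the chains deciding how to continue
(`Probe.Adapted.correctable_or_exists_moves`). The walks are finite, because otherwise the vectors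
met on the way would be linearly independent (`Probe.not_exists_infinite_moves`). The sum of the
rank one operators `ξ ⊗ e` along the way is an endomorphism of `X`, and as the walks do not return
it is an idempotent of rank one at `m`. By Fitting's lemma, `X` can only be indecomposable if
`dim X_m ≤ 1`.
-/

namespace GentleQuiver

/-! ### Sides of a vertex -/

section Sides

theorem exists_injective_bool {T : Type*} (hT : ENat.card T ≤ 2) :
    ∃ f : T → Bool, Function.Injective f := by
  have hfin : Finite T := by
    rw [← ENat.card_lt_top]
    exact lt_of_le_of_lt hT (by decide)
  have := Fintype.ofFinite T
  have hc : Fintype.card T ≤ Fintype.card Bool := by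
    rw [ENat.card_eq_coe_fintype_card] at hT
    simpa using (by exact_mod_cast hT : Fintype.card T ≤ 2)
  obtain ⟨f⟩ := Function.Embedding.nonempty_of_card_le hc
  exact ⟨f, f.injective⟩

/-- A relation between two sets of at most two elements, in which every row and every column has
at most one related and at most one unrelated entry, is the relation of having the same colour for
suitable injective two-colourings. -/
theorem exists_two_coloring {O N : Type*} (r : O → N → Prop)
    (hO : ENat.card O ≤ 2) (hN : ENat.card N ≤ 2)
    (h1 : ∀ α, {β | r α β}.Subsingleton) (h2 : ∀ α, {β | ¬ r α β}.Subsingleton)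
    (h3 : ∀ β, {α | r α β}.Subsingleton) (h4 : ∀ β, {α | ¬ r α β}.Subsingleton) :
    ∃ (o : O → Bool) (n : N → Bool), Function.Injective o ∧ Function.Injective n ∧
      ∀ α β, r α β ↔ n β = o α := by
  classical
  by_cases hne : Nonempty O
  · obtain ⟨α₀⟩ := hne
    obtain ⟨f, hf⟩ := exists_injective_bool hO
    have hr : ∀ α β, α ≠ α₀ → (r α β ↔ ¬ r α₀ β) := by
      intro α β hα
      by_cases ha : r α β <;> by_cases hb : r α₀ β
      · exact absurd (h3 β ha hb) hα
      · simp [ha, hb]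
      · simp [ha, hb]
      · exact absurd (h4 β ha hb) hα
    refine ⟨fun α => decide (α = α₀), fun β => decide (r α₀ β), ?_, ?_, ?_⟩
    · intro α α' h
      by_cases ha : α = α₀
      · have : α' = α₀ := by simpa [ha] using h
        rw [ha, this]
      · have hb : ¬ α' = α₀ := by simpa [ha] using h
        apply hf
        have h5 : f α ≠ f α₀ := fun h => ha (hf h)
        have h6 : f α' ≠ f α₀ := fun h => hb (hf h)
        revert h5 h6
        cases f α <;> cases f α' <;> cases f α₀ <;> simp
    · intro β β' h
      by_cases ha : r α₀ β
      · exact h1 α₀ ha (by simpa [ha] using h)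
      · exact h2 α₀ ha (by simpa [ha] using h)
    · intro α β
      by_cases ha : α = α₀
      · simp [ha]
      · simp [ha, hr α β ha]
  · obtain ⟨f, hf⟩ := exists_injective_bool hN
    exact ⟨fun _ => true, f, fun α => (hne ⟨α⟩).elim, hf, fun α => (hne ⟨α⟩).elim⟩

variable {K : Type u} [Field K] {V : Type v} [Quiver.{w} V]

variable (V) in
/-- The arrows of the quiver, bundled with their source `a.1` and target `a.2.1`. -/
abbrev Arrow : Type (max v w) := Σ a b : V, (a ⟶ b)

/-- A distribution of the ends of the arrows over two sides of each vertex: `out a` is the side of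
its source on which `a` leaves, `inn a` the side of its target on which `a` arrives. Each side of a
vertex has at most one arriving and at most one leaving arrow, and the composition of two arrows is
a relation exactly when they meet on the same side. A walk is a string precisely when it passes
every vertex from one side to the other. -/
structure Sides (I : TwoSidedIdeal (PathAlgebra K V)) where
  /-- the side of the source on which an arrow leaves -/
  out : Arrow V → Bool
  /-- the side of the target on which an arrow arrives -/
  inn : Arrow V → Bool
  out_inj : ∀ a b : Arrow V, a.1 = b.1 → out a = out b → a = b
  inn_inj : ∀ a b : Arrow V, a.2.1 = b.2.1 → inn a = inn b → a = b
  inRel_iff : ∀ {x y z : V} (β : x ⟶ y) (α : y ⟶ z), InRel I α β ↔ inn ⟨x, y, β⟩ = out ⟨y, z, α⟩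

theorem IsGentle.exists_sides {I : TwoSidedIdeal (PathAlgebra K V)} (hI : IsGentle I) :
    Nonempty (Sides I) := by
  have h := fun q : V => exists_two_coloring
    (fun (α : Σ b : V, (q ⟶ b)) (β : Σ a : V, (a ⟶ q)) => InRel I α.2 β.2)
    (hI.outgoing_le_two q) (hI.incoming_le_two q)
    (fun α => hI.before_mem α.2) (fun α => hI.before_notMem α.2)
    (fun β => hI.after_mem β.2) (fun β => hI.after_notMem β.2)
  choose o n ho hn hr using h
  refine ⟨⟨fun a => o a.1 ⟨a.2.1, a.2.2⟩, fun a => n a.2.1 ⟨a.1, a.2.2⟩, ?_, ?_, ?_⟩⟩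
  · rintro ⟨a, b, f⟩ ⟨a', b', f'⟩ (rfl : a = a') h2
    have := ho a h2
    simp only [Sigma.mk.injEq] at this
    obtain ⟨rfl, h⟩ := this
    simpa using h
  · rintro ⟨a, b, f⟩ ⟨a', b', f'⟩ (rfl : b = b') h2
    have := hn b h2
    simp only [Sigma.mk.injEq] at this
    obtain ⟨rfl, h⟩ := this
    simpa using h
  · intro x y z β α
    exact hr y ⟨z, α⟩ ⟨x, β⟩

end Sides

/-! ### Walks -/

namespace Sides

variable {K : Type u} [Field K] {V : Type v} [Quiver.{w} V]
  {I : TwoSidedIdeal (PathAlgebra K V)} (c : Sides I)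

/-- The arrow `a` has an end at the vertex `q` on the side `s`. -/
def At (a : Arrow V) (q : V) (s : Bool) : Prop :=
  (a.1 = q ∧ c.out a = s) ∨ (a.2.1 = q ∧ c.inn a = s)

/-- A state of a walk is a vertex with the side through which it is going to be left. Traversing
the arrow `a`, along or against its direction, leads from the state `x` to the state `y`. -/
def Joins (a : Arrow V) (x y : V × Bool) : Prop :=
  (x = (a.1, c.out a) ∧ y = (a.2.1, !c.inn a)) ∨ (x = (a.2.1, c.inn a) ∧ y = (a.1, !c.out a))

/-- One step of a walk. -/
def Step (x y : V × Bool) : Prop := ∃ a, c.Joins a x y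

/-- No walk starting at `m` comes back to `m`. -/
def NoReturn (m : V) : Prop :=
  ∀ (s : Bool) (x y : V × Bool), Relation.ReflTransGen c.Step (m, s) x → c.Step x y → y.1 ≠ m

variable {c}

theorem Step.reverse {x y : V × Bool} (h : c.Step x y) : c.Step (y.1, !y.2) (x.1, !x.2) := by
  obtain ⟨a, ⟨rfl, rfl⟩ | ⟨rfl, rfl⟩⟩ := h
  · exact ⟨a, Or.inr (by simp)⟩
  · exact ⟨a, Or.inl (by simp)⟩

theorem reach_reverse {x y : V × Bool} (h : Relation.ReflTransGen c.Step x y) :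
    Relation.ReflTransGen c.Step (y.1, !y.2) (x.1, !x.2) := by
  induction h with
  | refl => exact .refl
  | tail _ h ih => exact .head h.reverse ih

/-- If walks from `m` do not return, all of them pass a vertex in the same direction: otherwise one
could follow the first one and return along the second. -/
theorem NoReturn.direction_unique {m : V} (h : c.NoReturn m) {s s' : Bool} {q : V} {d d' : Bool}
    (hq : q ≠ m) (h1 : Relation.ReflTransGen c.Step (m, s) (q, d))
    (h2 : Relation.ReflTransGen c.Step (m, s') (q, d')) : d = d' := by
  by_contra hd
  have hd' : (!d') = d := by revert hd; cases d <;> cases d' <;> simp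
  have h3 := reach_reverse h2
  simp only [hd'] at h3
  rcases Relation.ReflTransGen.cases_tail h3 with h4 | ⟨z, h4, h5⟩
  · exact hq (congrArg Prod.fst h4).symm
  · exact h s z _ (h1.trans h4) h5 rfl

theorem Joins.at_left {a : Arrow V} {x y : V × Bool} (h : c.Joins a x y) : c.At a x.1 x.2 := by
  rcases h with ⟨rfl, rfl⟩ | ⟨rfl, rfl⟩ <;> simp [At]

theorem Joins.at_iff {a : Arrow V} {x y : V × Bool} (h : c.Joins a x y) (q : V) (s : Bool) :
    c.At a q s ↔ (x.1 = q ∧ x.2 = s) ∨ (y.1 = q ∧ (!y.2) = s) := by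
  rcases h with ⟨rfl, rfl⟩ | ⟨rfl, rfl⟩ <;> simp [At, or_comm]

theorem Joins.forall_ends {a : Arrow V} {x y : V × Bool} (h : c.Joins a x y) {P : V → Prop} :
    (P a.1 ∧ P a.2.1) ↔ (P x.1 ∧ P y.1) := by
  rcases h with ⟨rfl, rfl⟩ | ⟨rfl, rfl⟩ <;> simp [and_comm]

theorem Joins.iff_ends {a : Arrow V} {x y : V × Bool} (h : c.Joins a x y) {P : V → Prop} :
    (P a.1 ↔ P a.2.1) ↔ (P x.1 ↔ P y.1) := by
  rcases h with ⟨rfl, rfl⟩ | ⟨rfl, rfl⟩ <;> simp [Iff.comm]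

/-! ### Walks without repeated vertices -/

variable (c) in
/-- No two arrows in `B` compose to a relation. -/
def Free (B : Set (Arrow V)) : Prop :=
  ∀ α ∈ B, ∀ β ∈ B, β.2.1 = α.1 → c.inn β ≠ c.out α

/-- Every vertex in `S` is connected to `m` by edges in `B`: a property which holds at `m` and is
constant along the edges in `B` holds on `S`. -/
def ConnectedFrom (m : V) (S : Set V) (B : Set (Arrow V)) : Prop :=
  ∀ P : V → Prop, P m → (∀ a ∈ B, P a.1 ↔ P a.2.1) → ∀ q ∈ S, P q

variable (c) in
/-- There is a walk from `m` to the state `x` with pairwise different vertices, whose vertices form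
the set `S` and whose arrows form the set `B`. -/
inductive Arm (m : V) : Set V → Set (Arrow V) → V × Bool → Prop
  | nil (d : Bool) : Arm m {m} ∅ (m, d)
  | cons {S : Set V} {B : Set (Arrow V)} {x y : V × Bool} {a : Arrow V} : Arm m S B x →
      c.Joins a x y → y.1 ∉ S → Arm m (insert y.1 S) (insert a B) y

namespace Arm

variable {m : V} {S : Set V} {B : Set (Arrow V)} {x : V × Bool}

theorem start_mem (h : c.Arm m S B x) : m ∈ S := by
  induction h with
  | nil d => simp
  | cons _ _ _ ih => exact Set.mem_insert_of_mem _ ih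

theorem end_mem (h : c.Arm m S B x) : x.1 ∈ S := by
  cases h with
  | nil d => simp
  | cons _ _ _ => exact Set.mem_insert _ _

theorem ends_mem (h : c.Arm m S B x) : ∀ a ∈ B, a.1 ∈ S ∧ a.2.1 ∈ S := by
  induction h with
  | nil d => simp
  | @cons S B x y a h hj hy ih =>
    rintro a' (rfl | ha')
    · exact (hj.forall_ends (P := (· ∈ insert y.1 S))).2
        ⟨Set.mem_insert_of_mem _ h.end_mem, Set.mem_insert _ _⟩
    · exact ⟨Set.mem_insert_of_mem _ (ih a' ha').1, Set.mem_insert_of_mem _ (ih a' ha').2⟩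

theorem mem_of_at (h : c.Arm m S B x) {a : Arrow V} (ha : a ∈ B) {q : V} {s : Bool}
    (hq : c.At a q s) : q ∈ S := by
  rcases hq with ⟨rfl, -⟩ | ⟨rfl, -⟩
  exacts [(h.ends_mem a ha).1, (h.ends_mem a ha).2]

/-- The side on which an arm may be continued is unoccupied. -/
theorem not_at_end (h : c.Arm m S B x) : ∀ a ∈ B, ¬ c.At a x.1 x.2 := by
  cases h with
  | nil d => simp
  | @cons S B x y a h hj hy =>
    rintro a' (rfl | ha') hat
    · rcases (hj.at_iff _ _).1 hat with ⟨h1, -⟩ | ⟨-, h1⟩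
      · exact hy (h1 ▸ h.end_mem)
      · simp at h1
    · exact hy (h.mem_of_at ha' hat)

theorem notMem_of_joins (h : c.Arm m S B x) {a : Arrow V} {y : V × Bool} (hj : c.Joins a x y) :
    a ∉ B := fun ha => h.not_at_end a ha hj.at_left

theorem eq_of_end_eq_start (h : c.Arm m S B x) (hx : x.1 = m) : S = {m} ∧ B = ∅ := by
  cases h with
  | nil d => simp
  | cons h _ hy => exact absurd (hx ▸ h.start_mem) hy

/-- Adding to a relation-free set `B` an arrow that is not a loop and whose ends are on unoccupied
sides gives a relation-free set. -/
theorem free_insert {B : Set (Arrow V)} {x y : V × Bool} {a : Arrow V} (hB : c.Free B)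
    (hj : c.Joins a x y) (hxy : x.1 ≠ y.1) (h1 : ∀ a' ∈ B, ¬ c.At a' x.1 x.2)
    (h2 : ∀ a' ∈ B, ¬ c.At a' y.1 (!y.2)) : c.Free (insert a B) := by
  have key : ∀ a' ∈ B, ∀ q s, c.At a q s → ¬ c.At a' q s := by
    intro a' ha' q s hq hq'
    rcases (hj.at_iff q s).1 hq with ⟨rfl, rfl⟩ | ⟨rfl, rfl⟩
    exacts [h1 a' ha' hq', h2 a' ha' hq']
  rintro α (rfl | hα) β (rfl | hβ) hv hs
  · rcases hj with ⟨rfl, rfl⟩ | ⟨rfl, rfl⟩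
    exacts [hxy hv.symm, hxy hv]
  · exact key β hβ α.1 (c.out α) (Or.inl ⟨rfl, rfl⟩) (Or.inr ⟨hv, hs⟩)
  · exact key α hα β.2.1 (c.inn β) (Or.inr ⟨rfl, rfl⟩) (Or.inl ⟨hv.symm, hs.symm⟩)
  · exact hB α hα β hβ hv hs

theorem free (h : c.Arm m S B x) : c.Free B := by
  induction h with
  | nil d => intro a ha; simp at ha
  | cons h hj hy ih =>
    exact free_insert ih hj (fun hxy => hy (hxy ▸ h.end_mem)) h.not_at_end
      fun a' ha' hat => hy (h.mem_of_at ha' hat)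

theorem connectedFrom (h : c.Arm m S B x) : ConnectedFrom m S B := by
  induction h with
  | nil d => rintro P hm - q rfl; exact hm
  | @cons S B x y a h hj hy ih =>
    intro P hm hP
    have hS := ih P hm fun a' ha' => hP a' (Set.mem_insert_of_mem _ ha')
    rintro q (rfl | hq)
    · exact (hj.iff_ends.1 (hP a (Set.mem_insert _ _))).1 (hS _ h.end_mem)
    · exact hS q hq

/-- An arm that has passed the vertex `p` and left it through the arrow `b`: the part up to `p` is
an arm, and if `b` is deleted, what remains falls into the part before `b` and the part behind
it. -/
theorem exists_passage (h : c.Arm m S B x) {p : V} (hp : p ∈ S) (hpx : p ≠ x.1) :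
    ∃ (S₀ : Set V) (B₀ : Set (Arrow V)) (d : Bool) (b : Arrow V), c.Arm m S₀ B₀ (p, d) ∧
      b ∈ B ∧ (∀ a ∈ B \ {b}, ∀ s, c.At a p s → s ≠ d ∧ p ≠ m) ∧
      ∀ P : V → Prop, P m → (∀ a ∈ B \ {b}, P a.1 ↔ P a.2.1) →
        P p ∧ (P x.1 → ∀ q ∈ S, P q) := by
  induction h with
  | nil d => exact absurd hp hpx
  | @cons S B x y a h hj hy ih =>
    have hpS : p ∈ S := hp.resolve_left hpx
    have haB := h.notMem_of_joins hj
    by_cases hpx' : p = x.1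
    · subst hpx'
      refine ⟨S, B, x.2, a, h, Set.mem_insert _ _, ?_, ?_⟩
      · rintro a' ⟨ha', hne⟩ s hs
        have ha'' : a' ∈ B := ha'.resolve_left hne
        refine ⟨?_, fun hm => ?_⟩
        · rintro rfl
          exact h.not_at_end a' ha'' hs
        · rw [(h.eq_of_end_eq_start hm).2] at ha''
          exact ha''
      · intro P hm hP
        have hS := h.connectedFrom P hm fun a' ha' =>
          hP a' ⟨Set.mem_insert_of_mem _ ha', fun h => haB (h ▸ ha')⟩
        refine ⟨hS _ h.end_mem, ?_⟩
        rintro hy' q (rfl | hq)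
        exacts [hy', hS q hq]
    · obtain ⟨S₀, B₀, d, b, h0, hb, hat, hcon⟩ := ih hpS hpx'
      refine ⟨S₀, B₀, d, b, h0, Set.mem_insert_of_mem _ hb, ?_, ?_⟩
      · rintro a' ⟨rfl | ha', hne⟩ s hs
        · rcases (hj.at_iff _ _).1 hs with ⟨h1, -⟩ | ⟨h1, -⟩
          exacts [absurd h1.symm hpx', absurd h1.symm hpx]
        · exact hat a' ⟨ha', hne⟩ s hs
      · intro P hm hP
        obtain ⟨h1, h2⟩ := hcon P hm fun a' ha' => hP a' ⟨Set.mem_insert_of_mem _ ha'.1, ha'.2⟩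
        refine ⟨h1, fun hPy => ?_⟩
        have hPx : P x.1 := (hj.iff_ends.1
          (hP a ⟨Set.mem_insert _ _, fun h => haB (h ▸ hb)⟩)).2 hPy
        rintro q (rfl | hq)
        exacts [hPy, h2 hPx q hq]

end Arm

end Sides

/-! ### Operators on the total space of a representation -/

section Total

variable {K : Type u} [Field K] {V : Type v} [Quiver.{w} V]
  {I : TwoSidedIdeal (PathAlgebra K V)} (X : QuiverRep I)

namespace QuiverRep

/-- The total space of a representation. -/
abbrev Total : Type (max u v) := ∀ q, X.obj q

open Classical in
/-- The projection of the total space onto the summand at the vertex `q`. -/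
noncomputable def vertexProj (q : V) : Module.End K X.Total :=
  LinearMap.single K X.obj q ∘ₗ LinearMap.proj q

open Classical in
/-- The action of an arrow on the total space. -/
noncomputable def arrowMap (a : Arrow V) : Module.End K X.Total :=
  LinearMap.single K X.obj a.2.1 ∘ₗ X.map a.2.2 ∘ₗ LinearMap.proj a.1

variable {X}

theorem vertexProj_self (q : V) (x : X.Total) :
    X.vertexProj q (X.vertexProj q x) = X.vertexProj q x := by
  simp [vertexProj]

theorem vertexProj_of_ne {p q : V} (h : p ≠ q) (x : X.Total) :
    X.vertexProj p (X.vertexProj q x) = 0 := by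
  simp [vertexProj, h]

theorem vertexProj_arrowMap (a : Arrow V) (x : X.Total) :
    X.vertexProj a.2.1 (X.arrowMap a x) = X.arrowMap a x := by
  simp [vertexProj, arrowMap]

theorem vertexProj_arrowMap_of_ne {a : Arrow V} {q : V} (h : q ≠ a.2.1) (x : X.Total) :
    X.vertexProj q (X.arrowMap a x) = 0 := by
  simp [vertexProj, arrowMap, h]

theorem arrowMap_vertexProj (a : Arrow V) (x : X.Total) :
    X.arrowMap a (X.vertexProj a.1 x) = X.arrowMap a x := by
  simp [vertexProj, arrowMap]

theorem arrowMap_vertexProj_of_ne {a : Arrow V} {q : V} (h : q ≠ a.1) (x : X.Total) :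
    X.arrowMap a (X.vertexProj q x) = 0 := by
  simp [vertexProj, arrowMap, Ne.symm h]

theorem arrowMap_arrowMap (c : Sides I) {α β : Arrow V} (h : β.2.1 = α.1)
    (hs : c.inn β = c.out α) (x : X.Total) : X.arrowMap α (X.arrowMap β x) = 0 := by
  obtain ⟨p, q, β⟩ := β
  obtain ⟨q', r, α⟩ := α
  obtain rfl : q = q' := h
  have h2 := LinearMap.congr_fun (X.map_comp_eq_zero β α ((c.inRel_iff β α).2 hs)) (x p)
  simp only [LinearMap.comp_apply, LinearMap.zero_apply] at h2
  simp [arrowMap, h2]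

end QuiverRep

/-! ### Subspaces defined by walks -/

open QuiverRep

variable (c : Sides I)

/-- The subspaces of the total space that are defined, at the vertex `q`, by the walks leaving `q`
through the side `d`. -/
inductive WalkSubspace : V → Bool → Submodule K X.Total → Prop
  | bot (q : V) (d : Bool) : WalkSubspace q d ⊥
  | top (q : V) (d : Bool) : WalkSubspace q d ⊤
  | map {q : V} {d : Bool} (a : Arrow V) (W : Submodule K X.Total) : a.2.1 = q → c.inn a = d →
      WalkSubspace a.1 (!c.out a) W → WalkSubspace q d (W.map (X.arrowMap a))
  | comap {q : V} {d : Bool} (a : Arrow V) (W : Submodule K X.Total) : a.1 = q → c.out a = d →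
      WalkSubspace a.2.1 (!c.inn a) W → WalkSubspace q d (W.comap (X.arrowMap a))

variable {X c}

/-- The walk subspaces at a given side of a given vertex form a chain. -/
theorem WalkSubspace.total {q : V} {d : Bool} {W W' : Submodule K X.Total}
    (h : WalkSubspace X c q d W) (h' : WalkSubspace X c q d W') : W ≤ W' ∨ W' ≤ W := by
  induction h generalizing W' with
  | bot => exact Or.inl bot_le
  | top => exact Or.inr le_top
  | @map q d a W hq hd hW ih =>
    cases h' with
    | bot => exact Or.inr bot_le
    | top => exact Or.inl le_top
    | map b U hq' hd' hU =>
      obtain rfl := c.inn_inj a b (hq.trans hq'.symm) (hd.trans hd'.symm)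
      exact (ih hU).imp (fun h => Submodule.map_mono h) (fun h => Submodule.map_mono h)
    | comap b U hq' hd' hU =>
      left
      rintro _ ⟨x, -, rfl⟩
      rw [Submodule.mem_comap, arrowMap_arrowMap c (hq.trans hq'.symm) (hd.trans hd'.symm)]
      exact zero_mem _
  | @comap q d a W hq hd hW ih =>
    cases h' with
    | bot => exact Or.inr bot_le
    | top => exact Or.inl le_top
    | map b U hq' hd' hU =>
      right
      rintro _ ⟨x, -, rfl⟩
      rw [Submodule.mem_comap, arrowMap_arrowMap c (hq'.trans hq.symm) (hd'.trans hd.symm)]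
      exact zero_mem _
    | comap b U hq' hd' hU =>
      obtain rfl := c.out_inj a b (hq.trans hq'.symm) (hd.trans hd'.symm)
      exact (ih hU).imp (fun h => Submodule.comap_mono h) (fun h => Submodule.comap_mono h)

theorem WalkSubspace.vertexProj_mem {q : V} {d : Bool} {W : Submodule K X.Total}
    (h : WalkSubspace X c q d W) (p : V) {x : X.Total} (hx : x ∈ W) : X.vertexProj p x ∈ W := by
  cases h with
  | bot =>
    rw [Submodule.mem_bot] at hx ⊢
    rw [hx, map_zero]
  | top => trivial
  | map a W hq hd hW =>
    obtain ⟨y, hy, rfl⟩ := hx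
    by_cases hp : p = a.2.1
    · rw [hp, vertexProj_arrowMap]
      exact ⟨y, hy, rfl⟩
    · rw [vertexProj_arrowMap_of_ne hp]
      exact zero_mem _
  | comap a W hq hd hW =>
    rw [Submodule.mem_comap] at hx ⊢
    by_cases hp : p = a.1
    · rwa [hp, arrowMap_vertexProj]
    · rw [arrowMap_vertexProj_of_ne hp]
      exact zero_mem _

/-- In a family of subspaces of a finite-dimensional space that is a chain, there is a largest
member with a given property. -/
theorem exists_greatest {E : Type*} [AddCommGroup E] [Module K E] [FiniteDimensional K E]
    {F : Submodule K E → Prop} (hF : ∀ W W', F W → F W' → W ≤ W' ∨ W' ≤ W)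
    {P : Submodule K E → Prop} {W₀ : Submodule K E} (h0 : F W₀) (hP : P W₀) :
    ∃ U, F U ∧ P U ∧ ∀ W, F W → P W → W ≤ U := by
  obtain ⟨U, ⟨h1, h2⟩, h3⟩ := (wellFounded_gt (α := Submodule K E)).has_min
    {W | F W ∧ P W} ⟨W₀, h0, hP⟩
  refine ⟨U, h1, h2, fun W hW hPW => ?_⟩
  rcases hF W U hW h1 with h | h
  · exact h
  · by_contra h4
    exact h3 W ⟨hW, hPW⟩ (lt_of_le_not_ge h h4)

theorem exists_least {E : Type*} [AddCommGroup E] [Module K E] [FiniteDimensional K E]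
    {F : Submodule K E → Prop} (hF : ∀ W W', F W → F W' → W ≤ W' ∨ W' ≤ W)
    {P : Submodule K E → Prop} {W₀ : Submodule K E} (h0 : F W₀) (hP : P W₀) :
    ∃ U, F U ∧ P U ∧ ∀ W, F W → P W → U ≤ W := by
  obtain ⟨U, ⟨h1, h2⟩, h3⟩ := (wellFounded_lt (α := Submodule K E)).has_min
    {W | F W ∧ P W} ⟨W₀, h0, hP⟩
  refine ⟨U, h1, h2, fun W hW hPW => ?_⟩
  rcases hF U W h1 hW with h | h
  · exact h
  · by_contra h4
    exact h3 W ⟨hW, hPW⟩ (lt_of_le_not_ge h h4)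

/-! ### Following a vector and a functional along a walk -/

variable (X) in
/-- A state of a walk together with a vector and a linear functional on the total space. -/
structure Probe where
  /-- the vertex and the side through which it is going to be left -/
  pos : V × Bool
  /-- the vector -/
  vec : X.Total
  /-- the functional -/
  fn : X.Total →ₗ[K] K

namespace Probe

variable (c) in
/-- The vector and the functional live at the vertex `s.pos.1`, have pairing `1`, and each of the
walk subspaces ahead contains the vector or is annihilated by the functional. -/
structure Adapted (s : Probe X) : Prop where
  vec_mem : X.vertexProj s.pos.1 s.vec = s.vec
  fn_comp : ∀ x, s.fn (X.vertexProj s.pos.1 x) = s.fn x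
  pairing : s.fn s.vec = 1
  adapted : ∀ W, WalkSubspace X c s.pos.1 s.pos.2 W → s.vec ∈ W ∨ ∀ x ∈ W, s.fn x = 0

variable (c) in
/-- Traversing an arrow in its direction pushes the vector forward and extends the functional;
traversing it backwards lifts the vector and pulls the functional back. -/
inductive Moves : Probe X → Probe X → Prop
  | along (a : Arrow V) (e : X.Total) (ξ : X.Total →ₗ[K] K) :
      Moves ⟨(a.1, c.out a), e, ξ ∘ₗ X.arrowMap a⟩ ⟨(a.2.1, !c.inn a), X.arrowMap a e, ξ⟩
  | against (a : Arrow V) (e : X.Total) (ξ : X.Total →ₗ[K] K) :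
      Moves ⟨(a.2.1, c.inn a), X.arrowMap a e, ξ⟩ ⟨(a.1, !c.out a), e, ξ ∘ₗ X.arrowMap a⟩

open Classical in
variable (c) in
/-- The part of the commutator of the arrow `γ` with the operator `x ↦ ξ x • e` that is caused by
the end of `γ` on the side `d` of the vertex `q`. -/
noncomputable def defect (γ : Arrow V) (q : V) (d : Bool) (e : X.Total) (ξ : X.Total →ₗ[K] K) :
    Module.End K X.Total :=
  (if γ.1 = q ∧ c.out γ = d then ξ.smulRight (X.arrowMap γ e) else 0) -
    (if γ.2.1 = q ∧ c.inn γ = d then (ξ ∘ₗ X.arrowMap γ).smulRight e else 0)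

variable (c) in
/-- The rank one operator given by the probe `s` can be corrected, away from `m`, so that its
commutators caused by the arrows on the side `s.pos.2` disappear. -/
def Correctable (m : V) (s : Probe X) : Prop :=
  ∃ Ψ : Module.End K X.Total,
    (∀ γ, X.arrowMap γ ∘ₗ Ψ - Ψ ∘ₗ X.arrowMap γ = - defect c γ s.pos.1 s.pos.2 s.vec s.fn) ∧
    (∀ p, X.vertexProj p ∘ₗ Ψ = Ψ ∘ₗ X.vertexProj p) ∧ Ψ ∘ₗ X.vertexProj m = 0

theorem Moves.step {s s' : Probe X} (h : Moves c s s') : c.Step s.pos s'.pos := by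
  cases h with
  | along a e ξ => exact ⟨a, Or.inl ⟨rfl, rfl⟩⟩
  | against a e ξ => exact ⟨a, Or.inr ⟨rfl, rfl⟩⟩

/-- The full commutator is the sum of the contributions of the two sides. -/
theorem Adapted.commutator {s : Probe X} (h : Adapted c s) (γ : Arrow V) :
    X.arrowMap γ ∘ₗ s.fn.smulRight s.vec - s.fn.smulRight s.vec ∘ₗ X.arrowMap γ =
      defect c γ s.pos.1 s.pos.2 s.vec s.fn + defect c γ s.pos.1 (!s.pos.2) s.vec s.fn := by
  have h1 : γ.1 ≠ s.pos.1 → X.arrowMap γ s.vec = 0 := fun hne => by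
    rw [← h.vec_mem, arrowMap_vertexProj_of_ne hne.symm]
  have h2 : γ.2.1 ≠ s.pos.1 → ∀ x, s.fn (X.arrowMap γ x) = 0 := fun hne x => by
    rw [← h.fn_comp, vertexProj_arrowMap_of_ne hne.symm, map_zero]
  have e1 : X.arrowMap γ ∘ₗ s.fn.smulRight s.vec = s.fn.smulRight (X.arrowMap γ s.vec) := by
    ext1 x; simp
  have e2 : s.fn.smulRight s.vec ∘ₗ X.arrowMap γ = (s.fn ∘ₗ X.arrowMap γ).smulRight s.vec := by
    ext1 x; simp
  rw [e1, e2]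
  unfold defect
  have f1 : γ.1 ≠ s.pos.1 → s.fn.smulRight (X.arrowMap γ s.vec) = 0 := fun hne => by
    rw [h1 hne]; ext1 x; simp
  have f2 : γ.2.1 ≠ s.pos.1 → (s.fn ∘ₗ X.arrowMap γ).smulRight s.vec = 0 := fun hne => by
    ext1 x; simp [h2 hne]
  generalize s.fn.smulRight (X.arrowMap γ s.vec) = A at *
  generalize (s.fn ∘ₗ X.arrowMap γ).smulRight s.vec = B at *
  by_cases g1 : γ.1 = s.pos.1 <;> by_cases g2 : γ.2.1 = s.pos.1 <;>
    cases hd : s.pos.2 <;> cases ho : c.out γ <;> cases hi : c.inn γ <;>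
    simp [g1, g2, f1, f2, sub_eq_add_neg, add_comm]

/-- The defects of two consecutive probes on the sides facing each other cancel. -/
theorem Moves.defect_eq {s s' : Probe X} (h : Moves c s s') (γ : Arrow V) :
    defect c γ s'.pos.1 (!s'.pos.2) s'.vec s'.fn = - defect c γ s.pos.1 s.pos.2 s.vec s.fn := by
  classical
  have h1 : ∀ (a : Arrow V) (e : X.Total) (ξ : X.Total →ₗ[K] K),
      (if γ.1 = a.2.1 ∧ c.out γ = c.inn a then
        ξ.smulRight (X.arrowMap γ (X.arrowMap a e)) else 0) = 0 := by
    intro a e ξ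
    split_ifs with h
    · rw [arrowMap_arrowMap c h.1.symm h.2.symm]
      ext1 x; simp
    · rfl
  have h2 : ∀ (a : Arrow V) (e : X.Total) (ξ : X.Total →ₗ[K] K),
      (if γ.2.1 = a.1 ∧ c.inn γ = c.out a then
        ((ξ ∘ₗ X.arrowMap a) ∘ₗ X.arrowMap γ).smulRight e else 0) = 0 := by
    intro a e ξ
    split_ifs with h
    · ext1 x
      simp [arrowMap_arrowMap c h.1 h.2]
    · rfl
  cases h with
  | along a e ξ =>
    simp only [defect, Bool.not_not, h1, h2, zero_sub, sub_zero, neg_inj]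
    by_cases hγ : γ = a
    · subst hγ
      rw [if_pos ⟨rfl, rfl⟩, if_pos ⟨rfl, rfl⟩]
    · rw [if_neg fun h => hγ (c.inn_inj _ _ h.1 h.2), if_neg fun h => hγ (c.out_inj _ _ h.1 h.2)]
  | against a e ξ =>
    simp only [defect, Bool.not_not, h1, h2, zero_sub, sub_zero, neg_neg]
    by_cases hγ : γ = a
    · subst hγ
      rw [if_pos ⟨rfl, rfl⟩, if_pos ⟨rfl, rfl⟩]
    · rw [if_neg fun h => hγ (c.out_inj _ _ h.1 h.2), if_neg fun h => hγ (c.inn_inj _ _ h.1 h.2)]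

theorem Adapted.vertexProj_comm {s : Probe X} (h : Adapted c s) (p : V) :
    X.vertexProj p ∘ₗ s.fn.smulRight s.vec = s.fn.smulRight s.vec ∘ₗ X.vertexProj p := by
  ext1 x
  simp only [LinearMap.comp_apply, LinearMap.smulRight_apply, map_smul]
  by_cases hp : p = s.pos.1
  · subst hp
    rw [h.vec_mem, h.fn_comp]
  · rw [← h.vec_mem, vertexProj_of_ne hp, ← h.fn_comp (X.vertexProj p x),
      vertexProj_of_ne (Ne.symm hp)]
    simp

theorem Moves.correctable {m : V} {s s' : Probe X} (h : Moves c s s') (hs' : Adapted c s')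
    (hm : s'.pos.1 ≠ m) (hcor : Correctable c m s') : Correctable c m s := by
  obtain ⟨Ψ, h1, h2, h3⟩ := hcor
  refine ⟨s'.fn.smulRight s'.vec + Ψ, fun γ => ?_, fun p => ?_, ?_⟩
  · have h4 := hs'.commutator γ
    rw [h.defect_eq γ] at h4
    have h5 := h1 γ
    rw [LinearMap.comp_add, LinearMap.add_comp, add_sub_add_comm, h4, h5]
    abel
  · rw [LinearMap.comp_add, LinearMap.add_comp, hs'.vertexProj_comm, h2]
  · rw [LinearMap.add_comp, h3, add_zero]
    ext1 x
    rw [LinearMap.comp_apply, LinearMap.smulRight_apply, ← hs'.fn_comp, vertexProj_of_ne hm]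
    simp

/-- A probe can be moved on, unless there is nothing left to be corrected. -/
theorem Adapted.correctable_or_exists_moves [Finite V] (m : V) {s : Probe X} (h : Adapted c s) :
    Correctable c m s ∨ ∃ s', Moves c s s' ∧ Adapted c s' := by
  classical
  obtain ⟨⟨q, d⟩, e, ξ⟩ := s
  by_cases h1 : ∃ a : Arrow V, a.1 = q ∧ c.out a = d ∧ X.arrowMap a e ≠ 0
  · obtain ⟨a, rfl, rfl, ha⟩ := h1
    right
    obtain ⟨U, hU, heU, hmax⟩ := exists_greatest
      (F := WalkSubspace X c a.2.1 (!c.inn a)) (fun W W' h h' => h.total h')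
      (P := fun W => X.arrowMap a e ∉ W) (WalkSubspace.bot _ _) (by simpa using ha)
    have hker : ∀ x, X.arrowMap a x ∈ U → ξ x = 0 :=
      (h.adapted _ (.comap a U rfl rfl hU)).resolve_left (by simpa using heU)
    have hmem : ξ ∈ LinearMap.range (Module.Dual.transpose (R := K) (U.mkQ ∘ₗ X.arrowMap a)) := by
      have h3 := LinearMap.range_dualMap_eq_dualAnnihilator_ker (K := K) (U.mkQ ∘ₗ X.arrowMap a)
      change ξ ∈ LinearMap.range (LinearMap.dualMap (U.mkQ ∘ₗ X.arrowMap a))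
      rw [h3, Submodule.mem_dualAnnihilator]
      intro x hx
      apply hker
      simpa using hx
    obtain ⟨η, hη⟩ := hmem
    have hη' : ∀ x, η (U.mkQ (X.arrowMap a x)) = ξ x := fun x => LinearMap.congr_fun hη x
    let ξ' : X.Total →ₗ[K] K := (η ∘ₗ U.mkQ) ∘ₗ X.vertexProj a.2.1
    have hξ : ξ = ξ' ∘ₗ X.arrowMap a := by
      refine LinearMap.ext fun x => ?_
      simp only [ξ', LinearMap.comp_apply, vertexProj_arrowMap, hη']
    have hmv := Moves.along (c := c) a e ξ'
    rw [← hξ] at hmv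
    refine ⟨_, hmv, ⟨vertexProj_arrowMap a e, fun x => ?_, ?_, fun W hW => ?_⟩⟩
    · simp only [ξ', LinearMap.comp_apply, vertexProj_self]
    · have := h.pairing
      rwa [hξ] at this
    · by_cases hW' : X.arrowMap a e ∈ W
      · exact Or.inl hW'
      · refine Or.inr fun x hx => ?_
        have hxU := hU.vertexProj_mem a.2.1 (hmax W hW hW' hx)
        simp only [ξ', LinearMap.comp_apply, (Submodule.Quotient.mk_eq_zero U).2 hxU,
          Submodule.mkQ_apply, map_zero]
  · by_cases h2 : ∃ a : Arrow V, a.2.1 = q ∧ c.inn a = d ∧ ∃ x, ξ (X.arrowMap a x) ≠ 0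
    · obtain ⟨a, rfl, rfl, ha⟩ := h2
      right
      obtain ⟨U, hU, hξU, hmin⟩ := exists_least
        (F := WalkSubspace X c a.1 (!c.out a)) (fun W W' h h' => h.total h')
        (P := fun W => ∃ x ∈ W, ξ (X.arrowMap a x) ≠ 0) (WalkSubspace.top _ _) (by simpa using ha)
      have heU : e ∈ U.map (X.arrowMap a) := by
        refine (h.adapted _ (.map a U rfl rfl hU)).resolve_right fun h0 => ?_
        obtain ⟨x, hx, hx'⟩ := hξU
        exact hx' (h0 _ ⟨x, hx, rfl⟩)
      obtain ⟨e', he', hee⟩ := heU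
      have hee' : e = X.arrowMap a (X.vertexProj a.1 e') := by rw [arrowMap_vertexProj, hee]
      have hmv := Moves.against (c := c) a (X.vertexProj a.1 e') ξ
      rw [← hee'] at hmv
      refine ⟨_, hmv, ⟨vertexProj_self _ _, fun x => ?_, ?_, fun W hW => ?_⟩⟩
      · simp only [LinearMap.comp_apply, arrowMap_vertexProj]
      · have := h.pairing
        rwa [hee'] at this
      · by_cases hW' : ∃ x ∈ W, ξ (X.arrowMap a x) ≠ 0
        · exact Or.inl (hmin W hW hW' (hU.vertexProj_mem _ he'))
        · push Not at hW'
          exact Or.inr hW'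
    · left
      push Not at h1 h2
      refine ⟨0, fun γ => ?_, fun p => by simp, by simp⟩
      have e1 : (if γ.1 = q ∧ c.out γ = d then ξ.smulRight (X.arrowMap γ e) else 0) = 0 := by
        split_ifs with h
        · rw [h1 γ h.1 h.2]
          exact LinearMap.ext fun x => by simp
        · rfl
      have e2 : (if γ.2.1 = q ∧ c.inn γ = d then (ξ ∘ₗ X.arrowMap γ).smulRight e else 0) = 0 := by
        split_ifs with h
        · refine LinearMap.ext fun x => ?_
          simp [h2 γ h.1 h.2]
        · rfl
      simp only [defect, e1, e2]
      simp

/-- Weights ordering the histories of an infinite sequence of moves lexicographically, the most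
recent move being the most significant. A move against the direction of an arrow counts more. -/
theorem exists_weight {s : ℕ → Probe X} (hs : ∀ n, Moves c (s n) (s (n + 1))) :
    ∃ N : ℕ → ℚ, ∀ n, 0 ≤ N n ∧ N n < 1 ∧
      ((∃ a e ξ, s n = ⟨(a.1, c.out a), e, ξ ∘ₗ X.arrowMap a⟩ ∧
          s (n + 1) = ⟨(a.2.1, !c.inn a), X.arrowMap a e, ξ⟩ ∧ N (n + 1) = N n / 2) ∨
        (∃ a e ξ, s n = ⟨(a.2.1, c.inn a), X.arrowMap a e, ξ⟩ ∧
          s (n + 1) = ⟨(a.1, !c.out a), e, ξ ∘ₗ X.arrowMap a⟩ ∧ N (n + 1) = (1 + N n) / 2)) := by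
  have hb : ∀ n, ∃ b : Bool, (b = false ∧
      ∃ a e ξ, s n = ⟨(a.1, c.out a), e, ξ ∘ₗ X.arrowMap a⟩ ∧
        s (n + 1) = ⟨(a.2.1, !c.inn a), X.arrowMap a e, ξ⟩) ∨ (b = true ∧
      ∃ a e ξ, s n = ⟨(a.2.1, c.inn a), X.arrowMap a e, ξ⟩ ∧
        s (n + 1) = ⟨(a.1, !c.out a), e, ξ ∘ₗ X.arrowMap a⟩) := by
    intro n
    have := hs n
    generalize s n = t, s (n + 1) = t' at this
    cases this with
    | along a e ξ => exact ⟨false, Or.inl ⟨rfl, a, e, ξ, rfl, rfl⟩⟩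
    | against a e ξ => exact ⟨true, Or.inr ⟨rfl, a, e, ξ, rfl, rfl⟩⟩
  choose b hb using hb
  let N : ℕ → ℚ := fun n => Nat.rec 0 (fun n x => if b n then (1 + x) / 2 else x / 2) n
  have hN : ∀ n, N (n + 1) = if b n then (1 + N n) / 2 else N n / 2 := fun n => rfl
  have hN0 : ∀ n, 0 ≤ N n ∧ N n < 1 := by
    intro n
    induction n with
    | zero => simp [N]
    | succ n ih =>
      rw [hN]
      split_ifs <;> constructor <;> linarith [ih.1, ih.2]
  refine ⟨N, fun n => ⟨(hN0 n).1, (hN0 n).2, ?_⟩⟩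
  rcases hb n with ⟨hbn, a, e, ξ, h1, h2⟩ | ⟨hbn, a, e, ξ, h1, h2⟩
  · exact Or.inl ⟨a, e, ξ, h1, h2, by simp [hN, hbn]⟩
  · exact Or.inr ⟨a, e, ξ, h1, h2, by simp [hN, hbn]⟩

/-- An adapted probe cannot be moved forever if walks do not return: otherwise the vectors would
form an infinite linearly independent family, their pairings with the functionals being triangular
with respect to the lexicographic order of the histories. -/
theorem not_exists_infinite_moves [Finite V] {m : V} (hm : c.NoReturn m) {s : ℕ → Probe X}
    (h0 : (s 0).pos.1 = m) (hs : ∀ n, Moves c (s n) (s (n + 1))) (had : ∀ n, Adapted c (s n)) :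
    False := by
  classical
  obtain ⟨N, hN⟩ := exists_weight hs
  have hreach : ∀ n, Relation.ReflTransGen c.Step (m, (s 0).pos.2) (s n).pos := by
    intro n
    induction n with
    | zero => rw [← h0]
    | succ n ih => exact ih.tail (hs n).step
  have hne : ∀ n, (s (n + 1)).pos.1 ≠ m := fun n => hm _ _ _ (hreach n) (hs n).step
  have hdir : ∀ i j, (s (i + 1)).pos.1 = (s (j + 1)).pos.1 →
      (s (i + 1)).pos = (s (j + 1)).pos := by
    intro i j hij
    refine Prod.ext hij (hm.direction_unique (hne i) (hreach (i + 1)) (s' := (s 0).pos.2) ?_)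
    rw [hij]
    exact hreach (j + 1)
  -- follow the histories of `i` and `j` back to the first difference, which exists because the
  -- starting vertex is never visited again
  have key : ∀ i j, (s i).pos.1 = (s j).pos.1 → i ≠ j → (s j).fn (s i).vec = 0 ∨ N j < N i := by
    intro i
    induction i with
    | zero =>
      intro j hij hne'
      cases j with
      | zero => exact absurd rfl hne'
      | succ j => exact absurd (hij.symm.trans h0) (hne j)
    | succ i ih =>
      intro j hij hne'
      cases j with
      | zero => exact absurd (hij.trans h0) (hne i)
      | succ j =>
        have hpos := hdir i j hij
        have hij' : i ≠ j := fun h => hne' (by rw [h])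
        obtain ⟨hi0, hi1, hi⟩ := hN i
        obtain ⟨hj0, hj1, hj⟩ := hN j
        rcases hi with ⟨a, e, ξ, hi, hi', hiN⟩ | ⟨a, e, ξ, hi, hi', hiN⟩ <;>
          rcases hj with ⟨b, e', ξ', hj, hj', hjN⟩ | ⟨b, e', ξ', hj, hj', hjN⟩ <;>
          rw [hi', hj'] at hpos ⊢ <;>
          simp only [Prod.mk.injEq, Bool.not_inj_iff] at hpos
        · obtain rfl := c.inn_inj a b hpos.1 hpos.2
          have h5 := ih j (by rw [hi, hj]) hij'
          rw [hi, hj] at h5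
          refine h5.imp id fun h => ?_
          rw [hiN, hjN]
          linarith
        · left
          simp only [LinearMap.comp_apply]
          rw [arrowMap_arrowMap c hpos.1 hpos.2, map_zero]
        · right
          rw [hiN, hjN]
          linarith
        · obtain rfl := c.out_inj a b hpos.1 hpos.2
          have h5 := ih j (by rw [hi, hj]) hij'
          rw [hi, hj] at h5
          refine h5.imp id fun h => ?_
          rw [hiN, hjN]
          linarith
  have key' : ∀ i j, i ≠ j → (s j).fn (s i).vec = 0 ∨ N j < N i := by
    intro i j hij
    by_cases hq : (s i).pos.1 = (s j).pos.1
    · exact key i j hq hij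
    · left
      rw [← (had i).vec_mem, ← (had j).fn_comp, vertexProj_of_ne (Ne.symm hq), map_zero]
  have hli : LinearIndependent K fun n => (s n).vec := by
    rw [linearIndependent_iff']
    intro t g hg
    by_contra! hcon
    obtain ⟨i₀, hi₀, hgi₀⟩ := hcon
    -- the functional at the position of largest weight isolates a single coefficient
    obtain ⟨j, hj, hmax⟩ := (t.filter fun i => g i ≠ 0).exists_max_image
      N ⟨i₀, by simp [hi₀, hgi₀]⟩
    rw [Finset.mem_filter] at hj
    have h5 := congrArg (s j).fn hg
    rw [map_sum, map_zero, Finset.sum_eq_single j] at h5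
    · rw [map_smul, (had j).pairing, smul_eq_mul, mul_one] at h5
      exact hj.2 h5
    · intro i hi hij
      by_cases hgi : g i = 0
      · rw [hgi, zero_smul, map_zero]
      · rcases key' i j hij with h | h
        · rw [map_smul, h, smul_zero]
        · have := hmax i (by simp [hi, hgi])
          linarith
    · exact fun h => absurd hj.1 h
  have := hli.finite
  exact not_finite ℕ

theorem Adapted.correctable [Finite V] {m : V} (hm : c.NoReturn m) {s : Probe X}
    (hs : Adapted c s) (hsm : s.pos.1 = m) : Correctable c m s := by
  by_contra hcon
  let T := {t : Probe X // Adapted c t ∧ ¬ Correctable c m t ∧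
    Relation.ReflTransGen c.Step (m, s.pos.2) t.pos}
  have hnext : ∀ t : T, ∃ t' : T, Moves c t.1 t'.1 := by
    rintro ⟨t, h1, h2, h3⟩
    obtain ⟨t', h4, h5⟩ := (h1.correctable_or_exists_moves m).resolve_left h2
    exact ⟨⟨t', h5, fun h => h2 (h4.correctable h5 (hm _ _ _ h3 h4.step) h), h3.tail h4.step⟩, h4⟩
  choose f hf using hnext
  let t₀ : T := ⟨s, hs, hcon, by rw [← hsm]⟩
  exact not_exists_infinite_moves hm (s := fun n => (f^[n] t₀).1) hsm
    (fun n => by simpa only [Function.iterate_succ_apply'] using hf (f^[n] t₀))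
    fun n => (f^[n] t₀).2.1

end Probe

end Total

/-! ### Splitting off a summand -/

section Splitting

open QuiverRep Probe

variable {K : Type u} [Field K] {V : Type v} [Quiver.{w} V]
  {I : TwoSidedIdeal (PathAlgebra K V)} {X : QuiverRep I} {c : Sides I}

/-- Two chains of subspaces have a common adapted vector: at every nonzero vertex there are a
vector and a functional adapted to the walks on both sides. -/
theorem exists_adapted [Finite V] (m : V) (hm : Nontrivial (X.obj m)) :
    ∃ (e : X.Total) (ξ : X.Total →ₗ[K] K), ∀ d, Adapted c ⟨(m, d), e, ξ⟩ := by
  classical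
  obtain ⟨y, hy⟩ := exists_ne (0 : X.obj m)
  have hy' : X.vertexProj m (Pi.single m y) = Pi.single m y := by simp [vertexProj]
  -- the largest subspace of the first chain not containing the whole space at `m`
  obtain ⟨A, hA, hAm, hmax⟩ := exists_greatest
    (F := WalkSubspace X c m true) (fun W W' h h' => h.total h')
    (P := fun W => ¬ LinearMap.range (X.vertexProj m) ≤ W) (WalkSubspace.bot _ _) (by
      intro h
      have := h ⟨Pi.single m y, hy'⟩
      rw [Submodule.mem_bot, Pi.single_eq_zero_iff] at this
      exact hy this)
  -- the smallest subspace of the second chain which is not contained in it at `m`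
  obtain ⟨B, hB, hBA, hmin⟩ := exists_least
    (F := WalkSubspace X c m false) (fun W W' h h' => h.total h')
    (P := fun W => ∃ x ∈ W, X.vertexProj m x ∉ A) (WalkSubspace.top _ _) (by
      rw [SetLike.not_le_iff_exists] at hAm
      obtain ⟨_, ⟨x, rfl⟩, hx⟩ := hAm
      exact ⟨x, trivial, hx⟩)
  obtain ⟨x, hxB, hxA⟩ := hBA
  obtain ⟨f, hf, hfA⟩ := Submodule.exists_le_ker_of_notMem hxA
  have he := hB.vertexProj_mem m hxB
  set e := X.vertexProj m x with hedef
  have hee : X.vertexProj m e = e := vertexProj_self _ _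
  refine ⟨e, (f e)⁻¹ • (f ∘ₗ X.vertexProj m), fun d =>
    ⟨hee, fun z => by simp [vertexProj_self], ?_, fun W hW => ?_⟩⟩
  · simp only [LinearMap.smul_apply, LinearMap.comp_apply, hee, smul_eq_mul]
    exact inv_mul_cancel₀ hf
  · have hvan : (∀ z ∈ W, X.vertexProj m z ∈ A) →
        ∀ z ∈ W, ((f e)⁻¹ • (f ∘ₗ X.vertexProj m)) z = 0 := fun h z hz => by
      have : f (X.vertexProj m z) = 0 := hfA (h z hz)
      simp [this]
    cases d with
    | true =>
      by_cases h : LinearMap.range (X.vertexProj m) ≤ W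
      · exact Or.inl (h ⟨e, hee⟩)
      · exact Or.inr (hvan fun z hz => hmax W hW h (hW.vertexProj_mem m hz))
    | false =>
      by_cases h : ∃ z ∈ W, X.vertexProj m z ∉ A
      · exact Or.inl (hmin W hW h he)
      · push Not at h
        exact Or.inr (hvan h)

/-- If no walk from `m` returns to `m`, then the representation has an endomorphism which is an
idempotent of rank one at the vertex `m`. -/
theorem exists_hom_rank_one [Finite V] {m : V} (hm : c.NoReturn m)
    (hX : Nontrivial (X.obj m)) :
    ∃ (f : Hom X X) (e : X.obj m) (ξ : X.obj m →ₗ[K] K), ξ e = 1 ∧ ∀ x, f.app m x = ξ x • e := by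
  classical
  obtain ⟨e, ξ, had⟩ := exists_adapted (c := c) m hX
  obtain ⟨Ψ, h1, h2, h3⟩ := (had true).correctable hm rfl
  obtain ⟨Ψ', h1', h2', h3'⟩ := (had false).correctable hm rfl
  let Φ : Module.End K X.Total := ξ.smulRight e + Ψ + Ψ'
  have hΦ : ∀ γ, X.arrowMap γ ∘ₗ Φ = Φ ∘ₗ X.arrowMap γ := by
    intro γ
    have h4 := (had true).commutator γ
    have h5 := h1 γ
    have h6 := h1' γ
    simp only [Bool.not_true] at h4 h5 h6
    rw [← sub_eq_zero]
    simp only [Φ, LinearMap.comp_add, LinearMap.add_comp]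
    rw [add_sub_add_comm, add_sub_add_comm, h4, h5, h6]
    abel
  have hΦV : ∀ p, X.vertexProj p ∘ₗ Φ = Φ ∘ₗ X.vertexProj p := by
    intro p
    simp only [Φ, LinearMap.comp_add, LinearMap.add_comp, h2, h2', (had true).vertexProj_comm]
  have hsingle : ∀ p (y : X.obj p), Φ (Pi.single p y) = Pi.single p (Φ (Pi.single p y) p) := by
    intro p y
    have h4 := LinearMap.congr_fun (hΦV p) (Pi.single p y)
    simp only [LinearMap.comp_apply, vertexProj, LinearMap.proj_apply, Pi.single_eq_same,
      LinearMap.single_apply] at h4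
    exact h4.symm
  refine ⟨⟨fun q => LinearMap.proj q ∘ₗ Φ ∘ₗ LinearMap.single K X.obj q, fun {a b} α => ?_⟩,
    e m, ξ ∘ₗ LinearMap.single K X.obj m, ?_, fun x => ?_⟩
  · ext1 x
    have h4 := congrFun (LinearMap.congr_fun (hΦ ⟨a, b, α⟩) (Pi.single a x)) b
    simpa [arrowMap] using h4
  · have h4 : Pi.single m (e m) = e := (had true).vec_mem
    have h5 := (had true).pairing
    simp only [LinearMap.comp_apply, LinearMap.single_apply]
    rw [h4]
    exact h5
  · have h4 : X.vertexProj m (Pi.single m x) = Pi.single m x := by simp [vertexProj]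
    have h5 := LinearMap.congr_fun h3 (Pi.single m x)
    have h6 := LinearMap.congr_fun h3' (Pi.single m x)
    simp only [LinearMap.comp_apply, h4, LinearMap.zero_apply] at h5 h6
    simp [Φ, h5, h6]

namespace QuiverRep

/-- The subrepresentation on a family of subspaces that is preserved by the arrows. -/
def subrep (X : QuiverRep I) (W : ∀ q, Submodule K (X.obj q))
    (hW : ∀ {a b : V} (α : a ⟶ b), ∀ x ∈ W a, X.map α x ∈ W b) : QuiverRep I where
  obj q := W q
  map α := (X.map α).restrict (hW α)
  map_comp_eq_zero β α h := by
    ext x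
    exact LinearMap.congr_fun (X.map_comp_eq_zero β α h) x

theorem isomorphic_directSum_subrep (X : QuiverRep I) {W W' : ∀ q, Submodule K (X.obj q)}
    (hW : ∀ {a b : V} (α : a ⟶ b), ∀ x ∈ W a, X.map α x ∈ W b)
    (hW' : ∀ {a b : V} (α : a ⟶ b), ∀ x ∈ W' a, X.map α x ∈ W' b)
    (h : ∀ q, IsCompl (W q) (W' q)) :
    X.Isomorphic ((X.subrep W hW).directSum (X.subrep W' hW')) := by
  have key : ∀ {a b : V} (α : a ⟶ b) (z : W a × W' a),
      ((W b).prodEquivOfIsCompl (W' b) (h b)).symm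
        (X.map α ((W a).prodEquivOfIsCompl (W' a) (h a) z)) =
      (⟨X.map α z.1, hW α _ z.1.2⟩, ⟨X.map α z.2, hW' α _ z.2.2⟩) := by
    intro a b α z
    rw [LinearEquiv.symm_apply_eq]
    simp
  refine ⟨⟨fun q => ((W q).prodEquivOfIsCompl (W' q) (h q)).symm.toLinearMap,
    fun {a b} α => LinearMap.ext fun x => ?_⟩,
    fun q => ((W q).prodEquivOfIsCompl (W' q) (h q)).symm.bijective⟩
  obtain ⟨z, rfl⟩ := ((W a).prodEquivOfIsCompl (W' a) (h a)).surjective x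
  refine Eq.trans ?_ (key α z).symm
  have h1 := ((W a).prodEquivOfIsCompl (W' a) (h a)).symm_apply_apply z
  exact congrArg (((X.subrep W hW).directSum (X.subrep W' hW')).map α) h1

theorem Hom.map_pow (f : Hom X X) (n : ℕ) {a b : V} (α : a ⟶ b) (x : X.obj a) :
    X.map α ((f.app a ^ n) x) = (f.app b ^ n) (X.map α x) := by
  induction n generalizing x with
  | zero => rfl
  | succ n ih =>
    rw [pow_succ, pow_succ, Module.End.mul_apply, Module.End.mul_apply, ih]
    congr 1
    exact LinearMap.congr_fun (f.comm α) x

/-- Fitting's lemma: a suitable power of an endomorphism of an indecomposable representation is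
zero at every vertex, or the endomorphism is injective at every vertex. -/
theorem Indecomposable.fitting [Finite V] (hX : X.Indecomposable) (f : Hom X X) :
    (∃ n, ∀ q, f.app q ^ n = 0) ∨ ∀ q, Function.Injective (f.app q) := by
  have hev : ∀ᶠ n in Filter.atTop, ∀ q,
      IsCompl (LinearMap.ker (f.app q ^ n)) (LinearMap.range (f.app q ^ n)) :=
    Filter.eventually_all.2 fun q => (f.app q).eventually_isCompl_ker_pow_range_pow
  obtain ⟨n, hn, hn1⟩ := (hev.and (Filter.eventually_ge_atTop 1)).exists
  have h := hX.2 _ _ (X.isomorphic_directSum_subrep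
    (W := fun q => LinearMap.ker (f.app q ^ n)) (W' := fun q => LinearMap.range (f.app q ^ n))
    (fun {a b} α x hx => by
      rw [LinearMap.mem_ker] at hx ⊢
      rw [← f.map_pow, hx, map_zero])
    (fun {a b} α x hx => by
      obtain ⟨y, rfl⟩ := hx
      exact ⟨X.map α y, (f.map_pow n α y).symm⟩) hn)
  rcases h with h | h
  · right
    intro q
    have h1 : LinearMap.ker (f.app q ^ n) = ⊥ := (Submodule.subsingleton_iff_eq_bot).1 (h q)
    rw [← LinearMap.ker_eq_bot, eq_bot_iff, ← h1]
    intro x hx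
    obtain ⟨k, rfl⟩ := Nat.exists_eq_add_of_le' hn1
    rw [LinearMap.mem_ker] at hx ⊢
    rw [pow_succ, Module.End.mul_apply, hx, map_zero]
  · left
    refine ⟨n, fun q => ?_⟩
    have h1 : LinearMap.range (f.app q ^ n) = ⊥ := (Submodule.subsingleton_iff_eq_bot).1 (h q)
    exact LinearMap.range_eq_bot.1 h1

end QuiverRep

/-- If no walk from `m` returns to `m`, then `m` is minuscule. -/
theorem Sides.NoReturn.isMinuscule [Finite V] {m : V} (hm : c.NoReturn m) : IsMinuscule I m := by
  intro X hX
  by_cases hnt : Nontrivial (X.obj m)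
  · obtain ⟨f, e, ξ, he, hf⟩ := exists_hom_rank_one hm hnt
    rcases hX.fitting f with ⟨n, hn⟩ | hinj
    · have h1 : ∀ k, (f.app m ^ k) e = e := by
        intro k
        induction k with
        | zero => rfl
        | succ k ih => rw [pow_succ, Module.End.mul_apply, hf, he, one_smul, ih]
      have h2 := h1 n
      rw [hn m, LinearMap.zero_apply] at h2
      rw [← h2, map_zero] at he
      exact absurd he zero_ne_one
    · have h1 : Function.Injective ξ := by
        intro x y hxy
        apply hinj m
        rw [hf, hf, hxy]
      simpa using LinearMap.finrank_le_finrank_of_injective h1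
  · rw [not_nontrivial_iff_subsingleton] at hnt
    rw [Module.finrank_zero_of_subsingleton]
    exact Nat.zero_le _

end Splitting

/-! ### Jordan types with a single block -/

section JordanType

variable {K : Type u} [Field K]

/-- The Young diagram with a single row of length `n`. -/
def rowDiagram (n : ℕ) : YoungDiagram where
  cells := {0} ×ˢ Finset.range n
  isLowerSet := by
    rintro ⟨i, j⟩ ⟨i', j'⟩ ⟨h1, h2⟩ h
    simp only [Finset.coe_product, Finset.coe_singleton, Finset.coe_range, Set.mem_prod,
      Set.mem_singleton_iff, Set.mem_Iio] at h ⊢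
    simp only at h1 h2
    omega

theorem mem_rowDiagram {n : ℕ} {c : ℕ × ℕ} : c ∈ rowDiagram n ↔ c.1 = 0 ∧ c.2 < n := by
  rw [← YoungDiagram.mem_cells]
  change c ∈ ({0} : Finset ℕ) ×ˢ Finset.range n ↔ _
  rw [Finset.mem_product, Finset.mem_singleton, Finset.mem_range]

theorem rowLen_rowDiagram (n : ℕ) : (rowDiagram n).rowLen 0 = n := by
  have h : ∀ j, j < (rowDiagram n).rowLen 0 ↔ j < n := fun j => by
    rw [← YoungDiagram.mem_iff_lt_rowLen, mem_rowDiagram]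
    simp
  exact le_antisymm (not_lt.1 fun h1 => lt_irrefl _ ((h _).1 h1))
    (not_lt.1 fun h1 => lt_irrefl _ ((h _).2 h1))

theorem sum_rowLen_le_card (μ : YoungDiagram) (k : ℕ) :
    ∑ i ∈ Finset.range k, μ.rowLen i ≤ μ.card := by
  have h : ∀ i, μ.rowLen i = (μ.row i).card := fun _ => μ.rowLen_eq_card
  simp only [h]
  rw [← Finset.card_biUnion]
  · refine Finset.card_le_card fun c hc => ?_
    rw [Finset.mem_biUnion] at hc
    obtain ⟨i, -, hi⟩ := hc
    exact (YoungDiagram.mem_row_iff.1 hi).1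
  · intro _ _ _ _ hij
    rw [Function.onFun, Finset.disjoint_left]
    intro c hc hc'
    exact hij ((YoungDiagram.mem_row_iff.1 hc).2.symm.trans (YoungDiagram.mem_row_iff.1 hc').2)

/-- A single row is the largest partition. -/
theorem dominated_rowDiagram {μ : YoungDiagram} {n : ℕ} (h : μ.card = n) :
    Dominated μ (rowDiagram n) := by
  intro k
  cases k with
  | zero => simp
  | succ k =>
    refine (sum_rowLen_le_card μ _).trans (h.le.trans ?_)
    rw [Finset.sum_range_succ', rowLen_rowDiagram]
    exact Nat.le_add_left _ _

theorem HasJordanType.card_eq {E : Type u} [AddCommGroup E] [Module K E] {f : E →ₗ[K] E}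
    {μ : YoungDiagram} (h : HasJordanType f μ) : μ.card = Module.finrank K E := by
  obtain ⟨e, -⟩ := h
  have : Fintype {c : ℕ × ℕ // c ∈ μ} := Fintype.subtype μ.cells YoungDiagram.mem_cells
  rw [Module.finrank_eq_card_basis e, Fintype.card_of_subtype μ.cells
    YoungDiagram.mem_cells]

/-- The cells of a single row. -/
def rowDiagramEquiv (n : ℕ) : Fin n ≃ {c : ℕ × ℕ // c ∈ rowDiagram n} where
  toFun i := ⟨(0, i), mem_rowDiagram.2 ⟨rfl, i.2⟩⟩
  invFun c := ⟨c.1.2, (mem_rowDiagram.1 c.2).2⟩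
  left_inv _ := rfl
  right_inv c := Subtype.ext (Prod.ext (mem_rowDiagram.1 c.2).1.symm rfl)

theorem hasJordanType_rowDiagram {E : Type u} [AddCommGroup E] [Module K E] {f : E →ₗ[K] E}
    {n : ℕ} (b : Module.Basis (Fin n) K E)
    (hb : ∀ i : Fin n, f (b i) = if h : (i : ℕ) + 1 < n then b ⟨i + 1, h⟩ else 0) :
    HasJordanType f (rowDiagram n) := by
  refine ⟨b.reindex (rowDiagramEquiv n), fun i j h => ?_⟩
  obtain ⟨rfl, hj⟩ := mem_rowDiagram.1 h
  have h1 : ∀ (k : ℕ) (hk : (0, k) ∈ rowDiagram n) (hk' : k < n),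
      b.reindex (rowDiagramEquiv n) ⟨(0, k), hk⟩ = b ⟨k, hk'⟩ := by
    intro k hk hk'
    rw [Module.Basis.reindex_apply]
    rfl
  rw [h1 j h hj, hb]
  by_cases hj' : j + 1 < n
  · have h2 : (0, j + 1) ∈ rowDiagram n := mem_rowDiagram.2 ⟨rfl, hj'⟩
    rw [dif_pos hj', dif_pos h2, h1 _ h2 hj']
  · rw [dif_neg hj', dif_neg fun h2 => hj' (mem_rowDiagram.1 h2).2]

theorem hasJordanType_zero {E : Type u} [AddCommGroup E] [Module K E] [FiniteDimensional K E]
    (h : Module.finrank K E ≤ 1) :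
    HasJordanType (0 : E →ₗ[K] E) (rowDiagram (Module.finrank K E)) := by
  refine hasJordanType_rowDiagram (Module.finBasis K E) fun i => ?_
  rw [dif_neg (by omega), LinearMap.zero_apply]

theorem hasJordanType_two {E : Type u} [AddCommGroup E] [Module K E] {f : E →ₗ[K] E}
    (hE : Module.finrank K E = 2) (hf : ∀ x, f (f x) = 0) (hf0 : f ≠ 0) :
    HasJordanType f (rowDiagram (Module.finrank K E)) := by
  obtain ⟨x, hx⟩ : ∃ x, f x ≠ 0 := by
    by_contra! h
    exact hf0 (LinearMap.ext h)
  have hli : LinearIndependent K ![x, f x] := by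
    rw [LinearIndependent.pair_iff]
    intro s t h
    have h1 := congrArg f h
    simp only [map_add, map_smul, hf, smul_zero, add_zero, map_zero, smul_eq_zero] at h1
    have hs := h1.resolve_right hx
    rw [hs, zero_smul, zero_add, smul_eq_zero] at h
    exact ⟨hs, h.resolve_right hx⟩
  rw [hE]
  refine hasJordanType_rowDiagram
    (basisOfLinearIndependentOfCardEqFinrank hli (by simp [hE])) fun i => ?_
  fin_cases i
  · simp
  · simp [hf]

end JordanType

/-! ### Generic Jordan form data and indecomposability -/

section Generic

variable {K : Type u} [Field K] {V : Type v} [Quiver.{w} V]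
  {I : TwoSidedIdeal (PathAlgebra K V)}

open QuiverRep

/-- A nilpotent endomorphism with a single Jordan block at every vertex is generic. -/
theorem HasJF.hasGenJF {X : QuiverRep I} {N : Hom X X} (hN : N.IsNilpotent)
    (h : HasJF N fun q => rowDiagram (Module.finrank K (X.obj q))) :
    HasGenJF X fun q => rowDiagram (Module.finrank K (X.obj q)) :=
  ⟨⟨N, hN, h⟩, fun _ _ _ hμ q => dominated_rowDiagram (hμ q).card_eq⟩

theorem QuiverRep.Isomorphic.map_eq_zero {X Y : QuiverRep I} (h : X.Isomorphic Y) {a b : V}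
    (α : a ⟶ b) (hY : Y.map α = 0) : X.map α = 0 := by
  obtain ⟨f, hf⟩ := h
  ext1 x
  apply (hf b).1
  have h1 := LinearMap.congr_fun (f.comm α) x
  rw [hY] at h1
  rw [LinearMap.zero_apply, map_zero]
  exact h1.symm

/-- A nonzero representation whose only idempotent endomorphisms are `0` and `1` is
indecomposable. -/
theorem QuiverRep.indecomposable_of_idempotent {M : QuiverRep I} (h0 : ¬ M.IsZero)
    (h : ∀ f : Hom M M, (∀ q x, f.app q (f.app q x) = f.app q x) →
      (∀ q x, f.app q x = 0) ∨ ∀ q x, f.app q x = x) : M.Indecomposable := by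
  refine ⟨h0, fun X Y ⟨f, hf⟩ => ?_⟩
  let F : ∀ q, M.obj q ≃ₗ[K] (X.obj q × Y.obj q) := fun q => LinearEquiv.ofBijective (f.app q) (hf q)
  let p : ∀ q, (X.obj q × Y.obj q) →ₗ[K] (X.obj q × Y.obj q) := fun q =>
    LinearMap.inl K _ _ ∘ₗ LinearMap.fst K _ _
  have hF : ∀ {a b : V} (α : a ⟶ b) (x : M.obj a),
      F b (M.map α x) = (X.map α (F a x).1, Y.map α (F a x).2) := fun {a b} α x =>
    (LinearMap.congr_fun (f.comm α) x).symm
  let g : Hom M M := ⟨fun q => (F q).symm.toLinearMap ∘ₗ p q ∘ₗ (F q).toLinearMap, by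
    intro a b α
    refine LinearMap.ext fun x => (F b).injective ?_
    simp [hF, p]⟩
  have hg : ∀ q x, g.app q x = (F q).symm (p q (F q x)) := fun q x => rfl
  rcases h g (fun q x => by simp [hg, p]) with h1 | h1
  · left
    intro q
    refine subsingleton_of_forall_eq 0 fun x => ?_
    have h2 := h1 q ((F q).symm (x, 0))
    rw [hg, LinearEquiv.map_eq_zero_iff] at h2
    simpa [p] using h2
  · right
    intro q
    refine subsingleton_of_forall_eq 0 fun y => ?_
    have h2 := h1 q ((F q).symm (0, y))
    rw [hg, EmbeddingLike.apply_eq_iff_eq] at h2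
    simpa [p] using h2.symm

/-! ### Representations with constant vector spaces -/

open Classical in
/-- The representation with the space `W` at the vertices in `S` and zero elsewhere, on which the
arrow `a` acts as `ρ a` if it connects vertices in `S`. The zero spaces are written as spaces of
functions on an empty type. -/
noncomputable def constRep (S : Set V) (W : Type u) [AddCommGroup W] [Module K W]
    [FiniteDimensional K W] (ρ : Arrow V → Module.End K W)
    (hρ : ∀ {a b d : V} (β : a ⟶ b) (α : b ⟶ d), InRel I α β → ρ ⟨b, d, α⟩ * ρ ⟨a, b, β⟩ = 0) :
    QuiverRep I where
  obj q := PLift (q ∈ S) → W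
  map {a b} α :=
    { toFun := fun f _ => if h : a ∈ S then ρ ⟨a, b, α⟩ (f ⟨h⟩) else 0
      map_add' := fun f g => by
        ext
        split_ifs <;> simp
      map_smul' := fun r f => by
        ext
        split_ifs <;> simp }
  map_comp_eq_zero {a b d} β α h := by
    refine LinearMap.ext fun f => funext fun _ => ?_
    by_cases hb : b ∈ S <;> by_cases ha : a ∈ S
    · have h1 := LinearMap.congr_fun (hρ β α h) (f ⟨ha⟩)
      simpa [ha, hb] using h1
    all_goals simp [ha, hb]

section ConstRep

variable {S : Set V} {W : Type u} [AddCommGroup W] [Module K W] [FiniteDimensional K W]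
  {ρ : Arrow V → Module.End K W}
  {hρ : ∀ {a b d : V} (β : a ⟶ b) (α : b ⟶ d), InRel I α β → ρ ⟨b, d, α⟩ * ρ ⟨a, b, β⟩ = 0}

open Classical in
theorem constRep_map_apply {a b : V} (α : a ⟶ b) (f : PLift (a ∈ S) → W) :
    (constRep S W ρ hρ).map α f =
      fun _ : PLift (b ∈ S) => if h : a ∈ S then ρ ⟨a, b, α⟩ (f ⟨h⟩) else 0 := rfl

theorem constRep_map {a b : V} (α : a ⟶ b) (ha : a ∈ S) (w : W) :
    (constRep S W ρ hρ).map α (fun _ : PLift (a ∈ S) => w) =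
      fun _ : PLift (b ∈ S) => ρ ⟨a, b, α⟩ w := by
  rw [constRep_map_apply]
  simp only [dif_pos ha]
  rfl

theorem constRep_map_eq_zero_iff {a b : V} (α : a ⟶ b) (ha : a ∈ S) (hb : b ∈ S) :
    (constRep S W ρ hρ).map α = 0 ↔ ρ ⟨a, b, α⟩ = 0 := by
  constructor
  · intro h
    ext1 w
    have h1 := LinearMap.congr_fun h (fun _ : PLift (a ∈ S) => w)
    rw [constRep_map α ha] at h1
    exact congrFun h1 ⟨hb⟩
  · intro h
    refine LinearMap.ext fun f => (constRep_map_apply α f).trans (funext fun _ => ?_)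
    rw [dif_pos ha, h]
    rfl

theorem finrank_constRep_of_mem {q : V} (hq : q ∈ S) :
    Module.finrank K ((constRep S W ρ hρ).obj q) = Module.finrank K W := by
  have : Unique (PLift (q ∈ S)) := ⟨⟨⟨hq⟩⟩, fun _ => rfl⟩
  exact (LinearEquiv.funUnique (PLift (q ∈ S)) K W).finrank_eq

theorem finrank_constRep_of_notMem {q : V} (hq : q ∉ S) :
    Module.finrank K ((constRep S W ρ hρ).obj q) = 0 := by
  have : IsEmpty (PLift (q ∈ S)) := ⟨fun h => hq h.down⟩
  exact Module.finrank_zero_of_subsingleton (M := PLift (q ∈ S) → W)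

/-- If the arrows acting as the identity connect `S`, then an idempotent endomorphism is given by a
single idempotent of `W`, commuting with the action of all arrows. -/
theorem constRep_indecomposable {m : V} {B : Set (Arrow V)} (hW : Nontrivial W) (hm : m ∈ S)
    (hB : ∀ a ∈ B, a.1 ∈ S ∧ a.2.1 ∈ S ∧ ρ a = 1) (hcon : Sides.ConnectedFrom m S B)
    (hid : ∀ A : Module.End K W, A * A = A →
      (∀ a : Arrow V, a.1 ∈ S → a.2.1 ∈ S → ρ a * A = A * ρ a) → A = 0 ∨ A = 1) :
    (constRep S W ρ hρ).Indecomposable := by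
  apply indecomposable_of_idempotent
  · intro h
    obtain ⟨w, hw⟩ := exists_ne (0 : W)
    have h1 := (h m).elim (fun _ => w) (fun _ => 0)
    exact hw (congrFun h1 ⟨hm⟩)
  · intro f hf
    let A : Module.End K W :=
      { toFun := fun w => (f.app m (fun _ : PLift (m ∈ S) => w) : PLift (m ∈ S) → W) ⟨hm⟩
        map_add' := fun w w' => congrFun
          ((f.app m).map_add (fun _ : PLift (m ∈ S) => w) (fun _ : PLift (m ∈ S) => w')) ⟨hm⟩
        map_smul' := fun r w => congrFun
          ((f.app m).map_smul r (fun _ : PLift (m ∈ S) => w)) ⟨hm⟩ }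
    have hcomm : ∀ {a b : V} (α : a ⟶ b) (x), (constRep S W ρ hρ).map α (f.app a x) =
        f.app b ((constRep S W ρ hρ).map α x) := fun α x => LinearMap.congr_fun (f.comm α) x
    have hA : ∀ q ∈ S, ∀ w, f.app q (fun _ : PLift (q ∈ S) => w) = fun _ => A w := by
      refine hcon _ (fun w => rfl) ?_
      rintro ⟨a, b, α⟩ ha
      obtain ⟨ha1, ha2, ha3⟩ := hB _ ha
      refine forall_congr' fun w => ?_
      have h1 := hcomm α (fun _ : PLift (a ∈ S) => w)
      rw [constRep_map α ha1, ha3] at h1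
      constructor
      · intro h2
        rw [h2, constRep_map α ha1, ha3] at h1
        exact h1.symm
      · intro h2
        refine funext fun _ => ?_
        have h3 : (constRep S W ρ hρ).map α (f.app a (fun _ : PLift (a ∈ S) => w)) =
          fun _ : PLift (b ∈ S) => A w := h1.trans h2
        have h4 := congrFun ((constRep_map_apply α _).symm.trans h3) ⟨ha2⟩
        simp only [dif_pos ha1, ha3] at h4
        exact h4
    have hA' : ∀ q (x : (constRep S W ρ hρ).obj q),
        f.app q x = fun h : PLift (q ∈ S) => A ((x : PLift (q ∈ S) → W) h) :=
      fun q x => funext fun h => by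
        have h1 : x = fun _ : PLift (q ∈ S) => (x : PLift (q ∈ S) → W) h :=
          funext fun _ : PLift (q ∈ S) =>
            congrArg (x : PLift (q ∈ S) → W) (PLift.down_injective rfl)
        exact (congrFun (congrArg (f.app q) h1) h).trans (congrFun (hA q h.down _) h)
    have hAA : A * A = A := by
      ext1 w
      have h1 := hf m (fun _ : PLift (m ∈ S) => w)
      rw [hA m hm, hA m hm] at h1
      exact congrFun h1 ⟨hm⟩
    have hAρ : ∀ a : Arrow V, a.1 ∈ S → a.2.1 ∈ S → ρ a * A = A * ρ a := by
      rintro ⟨a, b, α⟩ ha hb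
      ext1 w
      have h1 := hcomm α (fun _ : PLift (a ∈ S) => w)
      rw [constRep_map α ha, hA a ha, hA b hb, constRep_map α ha] at h1
      exact congrFun h1 ⟨hb⟩
    refine (hid A hAA hAρ).imp (fun h q x => ?_) fun h q x => ?_
    · rw [hA', h]
      rfl
    · rw [hA', h]
      rfl

theorem supportedAt_constRep {m : V} (hW : Nontrivial W) (hm : m ∈ S)
    (h : (constRep S W ρ hρ).Indecomposable) : supportedAt I m (constRep S W ρ hρ) := by
  refine .of _ ⟨h, ?_⟩
  rw [finrank_constRep_of_mem hm]
  exact Module.finrank_pos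

end ConstRep

end Generic

section Failure

open QuiverRep

variable {K : Type u} [Field K] {V : Type v} [Quiver.{w} V]
  {I : TwoSidedIdeal (PathAlgebra K V)} {c : Sides I}

/-! ### Thin representations -/

open Classical in
variable (K) in
/-- The action of the arrows on a thin representation: those in `B` act as the identity and all
others as zero. -/
noncomputable def thinAction (B : Set (Arrow V)) (a : Arrow V) : Module.End K K :=
  if a ∈ B then 1 else 0

theorem thinAction_mul {B : Set (Arrow V)} (hB : c.Free B) {x y z : V} (β : x ⟶ y) (α : y ⟶ z)
    (h : InRel I α β) : thinAction K B ⟨y, z, α⟩ * thinAction K B ⟨x, y, β⟩ = 0 := by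
  by_cases h1 : (⟨y, z, α⟩ : Arrow V) ∈ B
  · by_cases h2 : (⟨x, y, β⟩ : Arrow V) ∈ B
    · exact absurd ((c.inRel_iff β α).1 h) (hB _ h1 _ h2 rfl)
    · simp [thinAction, h2]
  · simp [thinAction, h1]

variable (c) in
/-- The thin representation with one-dimensional spaces at the vertices in `S`, on which the arrows
in `B` act as the identity and all others as zero. -/
noncomputable def thinRep (S : Set V) (B : Set (Arrow V)) (hB : c.Free B) : QuiverRep I :=
  constRep S K (thinAction K B) (thinAction_mul hB)

variable {S : Set V} {B : Set (Arrow V)} {hB : c.Free B}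

theorem thinRep_map_eq_zero_iff {a b : V} (α : a ⟶ b) (ha : a ∈ S) (hb : b ∈ S) :
    (thinRep c S B hB).map α = 0 ↔ (⟨a, b, α⟩ : Arrow V) ∉ B := by
  refine (constRep_map_eq_zero_iff (hρ := thinAction_mul hB) α ha hb).trans ?_
  simp [thinAction]

theorem thinRep_supportedAt {m : V} (hm : m ∈ S) (hBS : ∀ a ∈ B, a.1 ∈ S ∧ a.2.1 ∈ S)
    (hcon : Sides.ConnectedFrom m S B) : supportedAt I m (thinRep c S B hB) := by
  have hK : Nontrivial K := inferInstance
  refine supportedAt_constRep hK hm (constRep_indecomposable (hρ := thinAction_mul hB) hK hm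
    (fun a ha => ⟨(hBS a ha).1, (hBS a ha).2, if_pos ha⟩) hcon fun A hA _ => ?_)
  have h1 : A 1 * A 1 = A 1 := by
    have h2 := LinearMap.congr_fun hA 1
    rw [Module.End.mul_apply] at h2
    nth_rewrite 1 [← mul_one (A 1)] at h2
    rwa [← smul_eq_mul, map_smul, smul_eq_mul] at h2
  rcases IsIdempotentElem.iff_eq_zero_or_one.1 h1 with h | h
  · left
    ext
    simpa using h
  · right
    ext
    simpa using h

theorem finrank_thinRep_of_mem {q : V} (hq : q ∈ S) :
    Module.finrank K ((thinRep c S B hB).obj q) = 1 := by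
  rw [thinRep, finrank_constRep_of_mem (hρ := thinAction_mul hB) hq, Module.finrank_self]

theorem finrank_thinRep_of_notMem {q : V} (hq : q ∉ S) :
    Module.finrank K ((thinRep c S B hB).obj q) = 0 :=
  finrank_constRep_of_notMem (hρ := thinAction_mul hB) hq

theorem hasGenJF_of_finrank_le_one {X : QuiverRep I} (h : ∀ q, Module.finrank K (X.obj q) ≤ 1) :
    HasGenJF X fun q => rowDiagram (Module.finrank K (X.obj q)) :=
  HasJF.hasGenJF (N := ⟨fun _ => 0, by simp⟩) ⟨1, one_pos, by simp⟩
    fun q => hasJordanType_zero (h q)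

/-- Two thin representations with the same support have the same generic Jordan form data. -/
theorem JordanRecoverable.subset_of_thinRep {m : V} (hJR : JordanRecoverable (supportedAt I m))
    (hm : m ∈ S) (hBS : ∀ a ∈ B, a.1 ∈ S ∧ a.2.1 ∈ S) (hcon : Sides.ConnectedFrom m S B)
    (hB : c.Free B) {B' : Set (Arrow V)} (hBS' : ∀ a ∈ B', a.1 ∈ S ∧ a.2.1 ∈ S)
    (hcon' : Sides.ConnectedFrom m S B') (hB' : c.Free B') : B ⊆ B' := by
  have hle : ∀ {B : Set (Arrow V)} (hB : c.Free B) (q : V),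
      Module.finrank K ((thinRep c S B hB).obj q) ≤ 1 := by
    intro B hB q
    by_cases hq : q ∈ S
    · rw [finrank_thinRep_of_mem hq]
    · rw [finrank_thinRep_of_notMem hq]
      exact zero_le_one
  have heq : (fun q => rowDiagram (Module.finrank K ((thinRep c S B' hB').obj q))) =
      fun q => rowDiagram (Module.finrank K ((thinRep c S B hB).obj q)) := by
    funext q
    by_cases hq : q ∈ S
    · rw [finrank_thinRep_of_mem hq, finrank_thinRep_of_mem hq]
    · rw [finrank_thinRep_of_notMem hq, finrank_thinRep_of_notMem hq]
  have hiso := hJR _ _ _ (thinRep_supportedAt (hB := hB) hm hBS hcon)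
    (thinRep_supportedAt (hB := hB') hm hBS' hcon') (hasGenJF_of_finrank_le_one (hle hB))
    (heq ▸ hasGenJF_of_finrank_le_one (hle hB'))
  rintro ⟨a, b, α⟩ ha
  obtain ⟨h1, h2⟩ := hBS _ ha
  by_contra ha'
  exact (thinRep_map_eq_zero_iff α h1 h2).1
    (hiso.map_eq_zero α ((thinRep_map_eq_zero_iff α h1 h2).2 ha')) ha

/-! ### Doubling a thin representation along a loop -/

variable (K) in
/-- The nilpotent Jordan block of size two. -/
def jordanBlock : Module.End K (K × K) := LinearMap.inr K K K ∘ₗ LinearMap.fst K K K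

theorem jordanBlock_apply (x : K × K) : jordanBlock K x = (0, x.1) := rfl

theorem jordanBlock_mul_self : jordanBlock K * jordanBlock K = 0 :=
  LinearMap.ext fun x => by simp [jordanBlock_apply]

theorem jordanBlock_ne_zero : jordanBlock K ≠ 0 := fun h => by
  have h1 := LinearMap.congr_fun h (1, 0)
  simp [jordanBlock_apply] at h1

theorem eq_zero_or_eq_one_of_commute_jordanBlock {A : Module.End K (K × K)} (hA : A * A = A)
    (h : jordanBlock K * A = A * jordanBlock K) : A = 0 ∨ A = 1 := by
  obtain ⟨p, r, hpr⟩ : ∃ p r, A (1, 0) = (p, r) := ⟨_, _, rfl⟩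
  have h1 : A (0, 1) = (0, p) := by
    have h2 := LinearMap.congr_fun h (1, 0)
    simp only [Module.End.mul_apply, jordanBlock_apply, hpr] at h2
    exact h2.symm
  have hAx : ∀ x : K × K, A x = (x.1 * p, x.1 * r + x.2 * p) := by
    intro x
    have h2 : x = x.1 • (1, 0) + x.2 • (0, 1) := by ext <;> simp
    conv_lhs => rw [h2]
    rw [map_add, map_smul, map_smul, hpr, h1]
    ext <;> simp
  have h3 := LinearMap.congr_fun hA (1, 0)
  simp only [Module.End.mul_apply, hAx, Prod.mk.injEq, one_mul, zero_mul, add_zero] at h3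
  obtain ⟨h4, h5⟩ := h3
  rcases IsIdempotentElem.iff_eq_zero_or_one.1 h4 with rfl | rfl
  · have hr : r = 0 := by simpa using h5.symm
    left
    refine LinearMap.ext fun x => ?_
    simp [hAx, hr]
  · have hr : r = 0 := by simpa using h5
    right
    refine LinearMap.ext fun x => ?_
    simp [hAx, hr]

/-- If a walk without repeated vertices ends at a loop whose two ends are on the same side, then
the direct sum of two copies of its thin representation has the same generic Jordan form data as
the indecomposable representation in which the two copies are linked by the loop. -/
theorem JordanRecoverable.not_loop {m : V} (hJR : JordanRecoverable (supportedAt I m))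
    {x : V × Bool} (h : c.Arm m S B x) {a : Arrow V} (ha : c.Joins a x (x.1, !x.2)) : False := by
  classical
  have haB := h.notMem_of_joins ha
  have hends : a.1 = x.1 ∧ a.2.1 = x.1 := by
    rcases ha with ⟨h1, h2⟩ | ⟨h1, h2⟩
    · exact ⟨(congrArg Prod.fst h1).symm, (congrArg Prod.fst h2).symm⟩
    · exact ⟨(congrArg Prod.fst h2).symm, (congrArg Prod.fst h1).symm⟩
  have hsides : c.out a = x.2 ∧ c.inn a = x.2 := by
    rcases ha with ⟨h1, h2⟩ | ⟨h1, h2⟩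
    · exact ⟨(congrArg Prod.snd h1).symm, by simpa using (congrArg Prod.snd h2).symm⟩
    · exact ⟨by simpa using (congrArg Prod.snd h2).symm, (congrArg Prod.snd h1).symm⟩
  let ρ : Arrow V → Module.End K (K × K) := fun b =>
    if b ∈ B then 1 else if b = a then jordanBlock K else 0
  have hρB : ∀ b ∈ B, ρ b = 1 := fun b hb => if_pos hb
  have hρa : ρ a = jordanBlock K := by simp [ρ, haB]
  have hρ0 : ∀ b, b ∉ B → b ≠ a → ρ b = 0 := fun b h1 h2 => by simp [ρ, h1, h2]
  have hρ : ∀ {p q r : V} (β : p ⟶ q) (α : q ⟶ r), InRel I α β →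
      ρ ⟨q, r, α⟩ * ρ ⟨p, q, β⟩ = 0 := by
    intro p q r β α hrel
    have hs := (c.inRel_iff β α).1 hrel
    by_cases h1 : (⟨q, r, α⟩ : Arrow V) ∈ B
    · by_cases h2 : (⟨p, q, β⟩ : Arrow V) ∈ B
      · exact absurd hs (h.free _ h1 _ h2 rfl)
      · by_cases h3 : (⟨p, q, β⟩ : Arrow V) = a
        · refine absurd (Or.inl ⟨?_, ?_⟩) (h.not_at_end _ h1)
          · rw [← hends.2, ← h3]
          · rw [← hs, ← hsides.2, ← h3]
        · rw [hρ0 _ h2 h3, mul_zero]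
    · by_cases h3 : (⟨q, r, α⟩ : Arrow V) = a
      · by_cases h2 : (⟨p, q, β⟩ : Arrow V) ∈ B
        · refine absurd (Or.inr ⟨?_, ?_⟩) (h.not_at_end _ h2)
          · rw [← hends.1, ← h3]
          · rw [hs, ← hsides.1, ← h3]
        · by_cases h4 : (⟨p, q, β⟩ : Arrow V) = a
          · rw [h3, h4, hρa, jordanBlock_mul_self]
          · rw [hρ0 _ h2 h4, mul_zero]
      · rw [hρ0 _ h1 h3, zero_mul]
  have hnt : Nontrivial (K × K) := inferInstance
  have hx1 : a.1 ∈ S := hends.1 ▸ h.end_mem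
  have hx2 : a.2.1 ∈ S := hends.2 ▸ h.end_mem
  have hX : supportedAt I m (constRep S (K × K) ρ hρ) :=
    supportedAt_constRep hnt h.start_mem (constRep_indecomposable hnt h.start_mem
      (fun b hb => ⟨(h.ends_mem b hb).1, (h.ends_mem b hb).2, hρB b hb⟩) h.connectedFrom
      fun A hA hcomm => eq_zero_or_eq_one_of_commute_jordanBlock hA (hρa ▸ hcomm a hx1 hx2))
  let T := thinRep c S B h.free
  have hT : supportedAt I m T := thinRep_supportedAt h.start_mem h.ends_mem h.connectedFrom
  have hY : supportedAt I m (T.directSum T) := .directSum T T hT hT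
  have hρcomm : ∀ b x, ρ b (jordanBlock K x) = jordanBlock K (ρ b x) := by
    intro b x
    by_cases h1 : b ∈ B
    · rw [hρB b h1]
      rfl
    · by_cases h2 : b = a
      · rw [h2, hρa]
      · rw [hρ0 b h1 h2]
        simp
  -- both representations have the same dimensions: two at the vertices in `S`, zero elsewhere
  have hdX : ∀ q ∈ S, Module.finrank K ((constRep S (K × K) ρ hρ).obj q) = 2 := fun q hq => by
    rw [finrank_constRep_of_mem hq]
    simp
  have hdX' : ∀ q ∉ S, Module.finrank K ((constRep S (K × K) ρ hρ).obj q) = 0 := fun q hq =>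
    finrank_constRep_of_notMem hq
  have hdY : ∀ q ∈ S, Module.finrank K ((T.directSum T).obj q) = 2 := fun q hq => by
    have h1 : Module.finrank K (T.obj q × T.obj q) = 2 := by
      rw [Module.finrank_prod, finrank_thinRep_of_mem hq]
    exact h1
  have hdY' : ∀ q ∉ S, Module.finrank K ((T.directSum T).obj q) = 0 := fun q hq => by
    have h1 : Module.finrank K (T.obj q × T.obj q) = 0 := by
      rw [Module.finrank_prod, finrank_thinRep_of_notMem hq]
    exact h1
  let N : Hom (constRep S (K × K) ρ hρ) (constRep S (K × K) ρ hρ) :=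
    { app := fun q => ((jordanBlock K).compLeft (PLift (q ∈ S)) :
        (PLift (q ∈ S) → K × K) →ₗ[K] (PLift (q ∈ S) → K × K))
      comm := fun {p q} α => by
        refine LinearMap.ext fun f => (constRep_map_apply α _).trans (funext fun _ => ?_)
        change _ = jordanBlock K
          (if h : p ∈ S then ρ ⟨p, q, α⟩ ((f : PLift (p ∈ S) → K × K) ⟨h⟩) else 0)
        split_ifs
        · exact hρcomm _ _
        · exact (map_zero _).symm }
  let N' : Hom (T.directSum T) (T.directSum T) :=
    { app := fun q => LinearMap.inr K (T.obj q) (T.obj q) ∘ₗ LinearMap.fst K (T.obj q) (T.obj q)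
      comm := fun {p q} α => by
        refine LinearMap.ext fun f => ?_
        change (T.map α 0, T.map α f.1) = (0, T.map α f.1)
        rw [map_zero] }
  have hNN : ∀ q x, N.app q (N.app q x) = 0 := fun q x => rfl
  have hNN' : ∀ q x, N'.app q (N'.app q x) = 0 := fun q x => rfl
  have hN0 : ∀ q ∈ S, N.app q ≠ 0 := fun q hq h0 => by
    have h1 := congrFun (LinearMap.congr_fun h0 (fun _ : PLift (q ∈ S) => ((1, 0) : K × K))) ⟨hq⟩
    have h2 : ((0, 1) : K × K) = 0 := h1
    simp at h2
  have hN0' : ∀ q ∈ S, N'.app q ≠ 0 := fun q hq h0 => by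
    have : Nontrivial (T.obj q) := Module.nontrivial_of_finrank_pos (R := K)
      (by rw [finrank_thinRep_of_mem hq]; exact one_pos)
    obtain ⟨y, hy⟩ := exists_ne (0 : T.obj q)
    exact hy (congrArg Prod.snd (LinearMap.congr_fun h0 ((y, 0) : T.obj q × T.obj q)))
  have key : ∀ {X : QuiverRep I} (N : Hom X X), (∀ q ∈ S, Module.finrank K (X.obj q) = 2) →
      (∀ q ∉ S, Module.finrank K (X.obj q) = 0) → (∀ q x, N.app q (N.app q x) = 0) →
      (∀ q ∈ S, N.app q ≠ 0) →
      HasGenJF X fun q => rowDiagram (Module.finrank K (X.obj q)) := by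
    intro X N h1 h2 h3 h4
    refine HasJF.hasGenJF (N := N)
      ⟨2, two_pos, fun q => LinearMap.ext fun x => by rw [pow_two]; exact h3 q x⟩ fun q => ?_
    by_cases hq : q ∈ S
    · exact hasJordanType_two (h1 q hq) (h3 q) (h4 q hq)
    · have := Module.finrank_zero_iff.1 (h2 q hq)
      have h5 : N.app q = 0 := Subsingleton.elim _ _
      rw [h5]
      exact hasJordanType_zero (by rw [h2 q hq]; exact zero_le_one)
  have heq : (fun q => rowDiagram (Module.finrank K ((T.directSum T).obj q))) =
      fun q => rowDiagram (Module.finrank K ((constRep S (K × K) ρ hρ).obj q)) := by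
    funext q
    by_cases hq : q ∈ S
    · rw [hdX q hq, hdY q hq]
    · rw [hdX' q hq, hdY' q hq]
  have hiso := hJR _ _ _ hX hY (key N hdX hdX' hNN hN0) (heq ▸ key N' hdY hdY' hNN' hN0')
  obtain ⟨p, q, α⟩ := a
  have hT0 : T.map α = 0 := (thinRep_map_eq_zero_iff α hx1 hx2).2 haB
  have hY0 : (T.directSum T).map α = 0 := by
    change (T.map α).prodMap (T.map α) = 0
    rw [hT0, LinearMap.prodMap_zero]
  have h6 := (constRep_map_eq_zero_iff α hx1 hx2).1 (hiso.map_eq_zero α hY0)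
  rw [hρa] at h6
  exact jordanBlock_ne_zero h6

/-! ### Walks returning to `m` obstruct Jordan recoverability -/

/-- If the subcategory is Jordan recoverable, then a walk without repeated vertices can only be
continued in a way that does not return to `m` and leads to a state that is also reached without
repeated vertices. -/
theorem JordanRecoverable.exists_arm {m : V} (hJR : JordanRecoverable (supportedAt I m))
    {x y : V × Bool} (h : c.Arm m S B x) (hxy : c.Step x y) :
    y.1 ≠ m ∧ ∃ S' B', c.Arm m S' B' y := by
  obtain ⟨a, hj⟩ := hxy
  have haB := h.notMem_of_joins hj
  by_cases hyS : y.1 ∈ S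
  swap
  · exact ⟨fun hym => hyS (hym ▸ h.start_mem), _, _, h.cons hj hyS⟩
  by_cases hyx : y.1 = x.1
  · -- the arrow is a loop
    obtain ⟨y1, y2⟩ := y
    obtain rfl : y1 = x.1 := hyx
    -- if its ends are on different sides, it leads back to the state `x`; at `m` this is excluded,
    -- since the loop can act there both as zero and as the identity
    by_cases hd : y2 = x.2
    · subst hd
      refine ⟨fun hxm => ?_, S, B, h⟩
      obtain ⟨rfl, rfl⟩ := h.eq_of_end_eq_start hxm
      have hends := (hj.forall_ends (P := (· = m))).2 ⟨hxm, hxm⟩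
      have hfree : c.Free {a} := by
        rintro α rfl β rfl - hs
        rcases hj with ⟨h1, h2⟩ | ⟨h1, h2⟩ <;>
          · have h3 := congrArg Prod.snd h1
            have h4 := congrArg Prod.snd h2
            simp only [hs] at h3 h4
            rw [h3] at h4
            simp at h4
      have h1 := hJR.subset_of_thinRep (c := c) (S := {m}) (B := {a}) (B' := ∅) rfl
        (by rintro _ rfl; exact hends) (by rintro P hP - q rfl; exact hP) hfree
        (by simp) h.connectedFrom h.free
      exact h1 rfl
    · have hd' : y2 = !x.2 := by revert hd; cases y2 <;> cases x.2 <;> simp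
      subst hd'
      exact (hJR.not_loop h hj).elim
  · obtain ⟨S₀, B₀, d, b, h0, hb, hat, hcon⟩ := h.exists_passage hyS hyx
    by_cases hd : y.1 ≠ m ∧ y.2 = d
    · exact ⟨hd.1, S₀, B₀, by rwa [← hd.2] at h0⟩
    · -- exchanging the arrow `b`, through which the vertex `y.1` was left, for the arrow `a`
      exfalso
      have hfree : c.Free (insert a (B \ {b})) := by
        refine Sides.Arm.free_insert (fun α hα β hβ => h.free α hα.1 β hβ.1) hj (Ne.symm hyx)
          (fun a' ha' => h.not_at_end a' ha'.1) fun a' ha' hs => ?_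
        obtain ⟨h1, h2⟩ := hat a' ha' _ hs
        refine hd ⟨h2, ?_⟩
        revert h1
        cases y.2 <;> cases d <;> simp
      have hcon' : Sides.ConnectedFrom m S (insert a (B \ {b})) := by
        intro P hm hP
        obtain ⟨h1, h2⟩ := hcon P hm fun a' ha' => hP a' (Set.mem_insert_of_mem _ ha')
        exact h2 ((hj.iff_ends.1 (hP a (Set.mem_insert _ _))).2 h1)
      have hends : ∀ a' ∈ insert a (B \ {b}), a'.1 ∈ S ∧ a'.2.1 ∈ S := by
        rintro a' (rfl | ha')
        · exact (hj.forall_ends (P := (· ∈ S))).2 ⟨h.end_mem, hyS⟩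
        · exact h.ends_mem a' ha'.1
      exact haB (hJR.subset_of_thinRep h.start_mem hends hcon' hfree h.ends_mem h.connectedFrom
        h.free (Set.mem_insert _ _))

theorem JordanRecoverable.noReturn {m : V} (hJR : JordanRecoverable (supportedAt I m))
    (c : Sides I) : c.NoReturn m := by
  intro s x y hx hxy
  have harm : ∃ S B, c.Arm m S B x := by
    clear hxy
    induction hx with
    | refl => exact ⟨_, _, .nil s⟩
    | tail _ hstep ih =>
      obtain ⟨S, B, h⟩ := ih
      exact (hJR.exists_arm h hstep).2
  obtain ⟨S, B, h⟩ := harm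
  exact (hJR.exists_arm h hxy).1

end Failure

end GentleQuiver

theorem mainTheorem4 {K : Type u} [Field K] [IsAlgClosed K]
    {V : Type v} [Quiver.{w} V] [Finite V] [∀ a b : V, Finite (a ⟶ b)]
    (hconn : GentleQuiver.IsConnectedQuiver V)
    (I : TwoSidedIdeal (GentleQuiver.PathAlgebra K V)) (hI : GentleQuiver.IsGentle I)
    (m : V) (hm : ¬ GentleQuiver.IsMinuscule I m) :
    ¬ GentleQuiver.JordanRecoverable (GentleQuiver.supportedAt I m) := by
  intro hJR
  obtain ⟨c⟩ := hI.exists_sides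
  exact hm (hJR.noReturn c).isMinuscule
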